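/- Let $\mathcal X\subset\mathbb R^d$, let $f:\mathcal X\to\mathcal X$ be measurable and let $\nu$ be an $f$-invariant ergodic Borel probability measure on $\mathcal X$ (for instance an ergodic SRB measure). Let $B(x,r)$ denote the ball of radius $r$ about $x$ in $\mathcal X$, let $\tilde x\in\mathcal X$, and assume: (A1) There is a monotonically decreasing sequence $\Theta(j)\to0$ such that for all bounded Lipschitz $\varphi_1,\varphi_2:\mathcal X\to\mathbb R$ and all $j\ge 0$, $$\left|\int\varphi_1\cdot\varphi_2\circ f^j\,d\nu-\int\varphi_1\,d\nu\int\varphi_2\,d\nu\right|\le\Theta(j)\,\|\varphi_1\|_{\mathrm{Lip}}\|\varphi_2\|_{\mathrm{Lip}},$$ where $\|\varphi\|_{\mathrm{Lip}}=\sup|\varphi|+\sup_{x\ne y}|\varphi(x)-\varphi(y)|/|x-y|$. (A2) There are $\delta>0$, $r_0>0$ and $C$ such that $|\nu(B(\tilde x,r+\epsilon))-\nu(B(\tilde x,r))|\le C\epsilon^\delta$ whenever $0<\epsilon<r<r_0$. (Local dimension) $\nu(B(\tilde x,r))>0$ for all $r>0$, and $\lim_{r\to0^+}\log\nu(B(\tilde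 x,r))/\log r$ exists in $\mathbb R$. Let $B_n=B(\tilde x,r_n)$, $n\ge1$, be a decreasing sequence of balls about $\tilde x$, and put $S_n(x)=\sum_{1\le k\le n}1_{B_k}(f^k(x))$ and $E_n=\sum_{1\le k\le n}\nu(B_k)$. 1. If $\Theta(n)=O(n^{-\zeta})$ for some $\zeta>0$ and there is $\beta\in(0,1)$ with $\nu(B_n)=n^{-\beta}$ for all sufficiently large $n$, then for $\nu$-a.e. $x\in\mathcal X$, as $n\to\infty$, $$S_n(x)=E_n+O(E_n^{\beta'})\quad\text{for every }\beta'>\frac{2\delta^{-1}+\beta+\zeta(1-\beta)}{2\zeta(1-\beta)}.$$ 2. If $\Theta(n)=O(\theta_0^n)$ for some $\theta_0\in(0,1)$ and there is a real $\beta\ne-1$ with $\nu(B_n)=(\log n)^\beta/n$ for all sufficiently large $n$, then for $\nu$-a.e. $x\in\mathcal X$, as $n\to\infty$, $$S_n(x)=E_n+O(E_n^{\beta'})\quad\text{for every }\beta'>\frac{2+\beta}{2(1+\beta)}.$$ -/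

import Mathlib

open MeasureTheory Filter Topology Asymptotics

namespace ShrinkingBalls

noncomputable section

variable {X : Type*} [MetricSpace X] [MeasurableSpace X]

/-- The Lipschitz norm `‖φ‖_∞ + Lip(φ)` of a bounded Lipschitz function. A pair of equal points
contributes `0 / 0 = 0` to the second supremum. -/
def lipNorm (φ : X → ℝ) : ℝ :=
  (⨆ x, |φ x|) + ⨆ p : X × X, |φ p.1 - φ p.2| / dist p.1 p.2

/-- `φ` belongs to the Banach space of bounded Lipschitz functions. -/
def IsBddLipschitz (φ : X → ℝ) : Prop :=
  (∃ K, LipschitzWith K φ) ∧ ∃ M : ℝ, ∀ x, |φ x| ≤ M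

/-- The correlation `|∫ φ₁ · φ₂ ∘ f^j dν - ∫ φ₁ dν ∫ φ₂ dν|`. -/
def corr (f : X → X) (ν : Measure X) (j : ℕ) (φ₁ φ₂ : X → ℝ) : ℝ :=
  |(∫ x, φ₁ x * φ₂ (f^[j] x) ∂ν) - (∫ x, φ₁ x ∂ν) * ∫ x, φ₂ x ∂ν|

/-- Decay of correlations, Lipschitz versus Lipschitz, with monotone rate function `Θ → 0`. -/
def DecayOfCorrelations (f : X → X) (ν : Measure X) (Θ : ℕ → ℝ) : Prop :=
  Antitone Θ ∧ Tendsto Θ atTop (𝓝 0) ∧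
    ∀ φ₁ φ₂ : X → ℝ, IsBddLipschitz φ₁ → IsBddLipschitz φ₂ →
      ∀ j : ℕ, corr f ν j φ₁ φ₂ ≤ Θ j * lipNorm φ₁ * lipNorm φ₂

/-- Regularity of `ν` on shrinking annuli about `c`, with exponent `δ > 0`. -/
def AnnulusRegular (ν : Measure X) (c : X) (δ : ℝ) : Prop :=
  0 < δ ∧ ∃ r₀ > (0 : ℝ), ∃ C : ℝ, ∀ ε r : ℝ, 0 < ε → ε < r → r < r₀ →
    |ν.real (Metric.ball c (r + ε)) - ν.real (Metric.ball c r)| ≤ C * ε ^ δ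

/-- The pointwise local dimension of `ν` exists at `c` and equals `D`. For the quotient of
logarithms to be meaningful all balls about `c` have positive measure. -/
def HasLocalDimension (ν : Measure X) (c : X) (D : ℝ) : Prop :=
  (∀ r : ℝ, 0 < r → 0 < ν.real (Metric.ball c r)) ∧
    Tendsto (fun r : ℝ => Real.log (ν.real (Metric.ball c r)) / Real.log r) (𝓝[>] 0) (𝓝 D)

/-- The balls `B(c, r n)`, `n ≥ 1`, are decreasing (nested). -/
def DecreasingBalls (c : X) (r : ℕ → ℝ) : Prop :=
  ∀ m n : ℕ, 1 ≤ m → m ≤ n → Metric.ball c (r n) ⊆ Metric.ball c (r m)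

/-- `S_n(x) = ∑_{1 ≤ k ≤ n} 1_{B_k}(f^k x)` with `B_k = B(c, r k)`. -/
def S (f : X → X) (c : X) (r : ℕ → ℝ) (n : ℕ) (x : X) : ℝ :=
  ∑ k ∈ Finset.Icc 1 n, (Metric.ball c (r k)).indicator (fun _ => (1 : ℝ)) (f^[k] x)

/-- `E_n = ∑_{1 ≤ k ≤ n} ν(B_k)` with `B_k = B(c, r k)`. -/
def E (ν : Measure X) (c : X) (r : ℕ → ℝ) (n : ℕ) : ℝ :=
  ∑ k ∈ Finset.Icc 1 n, ν.real (Metric.ball c (r k))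

end

end ShrinkingBalls

/-! The proof is a second-moment argument. Let V_n be the sum over i, j ≤ n of the positive parts of
the covariances of the hits 1_{B_i}∘f^i and 1_{B_j}∘f^j. If V_n = O(E_n^{2b}) and E_n → ∞, a
Rademacher–Menshov argument gives S_n - E_n = O(E_n^{β'}) almost everywhere for each β' > b
(`ae_forall_isBigO_rpow_of_posCovSum_le`). The dyadic blocks are cut in the scale of E_n, not of n,
so the logarithm lost by chaining is log E_n, which any β' > b absorbs. This matters when E_n is
itself only a power of log n.

To bound V_n, pairs at distance at most G contribute O(G E_n) by the trivial bound. For distant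
pairs the indicators are replaced by Lipschitz cutoffs at scale ε = n^{-1/δ}. The annuli then have
measure O(1/n), so the approximation costs O(E_n + 1) in total, while the squared Lipschitz norms
cost n^{2/δ} against the decay of Θ (`exists_posCovSum_hit_le`). Choosing G so that both parts are
O(E_n^{1+σ}) yields the threshold (1+σ)/2 (`ae_isBigO_of_gap`): G is a power of n under polynomial
decay and a multiple of log n under exponential decay. For β < -1 in the exponential case the
measures are summable, and the first Borel–Cantelli lemma suffices. -/

namespace ShrinkingBalls

/-! ### Dyadic chaining. -/

/-- The dyadic sum of squared increments of `u` on `[0, 2 ^ s]`. -/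
noncomputable def dyadicSquares (u : ℕ → ℝ) (s : ℕ) : ℝ :=
  ∑ l ∈ Finset.range (s + 1), ∑ q ∈ Finset.range (2 ^ (s - l)),
    (u ((q + 1) * 2 ^ l) - u (q * 2 ^ l)) ^ 2

theorem dyadicSquares_nonneg (u : ℕ → ℝ) (s : ℕ) : 0 ≤ dyadicSquares u s :=
  Finset.sum_nonneg fun _ _ => Finset.sum_nonneg fun _ _ => sq_nonneg _

theorem dyadicSquares_succ (u : ℕ → ℝ) (s : ℕ) :
    dyadicSquares u (s + 1) = dyadicSquares (fun q => u (2 * q)) s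
      + ∑ q ∈ Finset.range (2 ^ (s + 1)), (u (q + 1) - u q) ^ 2 := by
  unfold dyadicSquares
  rw [Finset.sum_range_succ']
  congr 1
  · refine Finset.sum_congr rfl fun l _ => ?_
    rw [Nat.add_sub_add_right]
    refine Finset.sum_congr rfl fun q _ => ?_
    congr 3 <;> ring
  · simp

/-- The deterministic dyadic chaining bound behind the Rademacher–Menshov inequality. -/
theorem sq_sub_le_dyadicSquares (s : ℕ) : ∀ (u : ℕ → ℝ) (j : ℕ), j ≤ 2 ^ s →
    (u j - u 0) ^ 2 ≤ (s + 1) * dyadicSquares u s := by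
  induction s with
  | zero =>
    intro u j hj
    have : j = 0 ∨ j = 1 := by simp at hj; omega
    rcases this with rfl | rfl
    · simp [dyadicSquares, sq_nonneg]
    · simp [dyadicSquares]
  | succ s ih =>
    intro u j hj
    have hj2 : j / 2 ≤ 2 ^ s := by rw [pow_succ] at hj; omega
    have h1 := ih (fun q => u (2 * q)) (j / 2) hj2
    have h2 : (u j - u (2 * (j / 2))) ^ 2
        ≤ ∑ q ∈ Finset.range (2 ^ (s + 1)), (u (q + 1) - u q) ^ 2 := by
      rcases Nat.even_or_odd' j with ⟨k, rfl | rfl⟩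
      · rw [Nat.mul_div_cancel_left _ two_pos]
        simp only [sub_self, ne_eq, OfNat.ofNat_ne_zero, not_false_eq_true, zero_pow]
        exact Finset.sum_nonneg fun _ _ => sq_nonneg _
      · have : (2 * k + 1) / 2 = k := by omega
        rw [this]
        exact Finset.single_le_sum (f := fun q => (u (q + 1) - u q) ^ 2)
          (fun _ _ => sq_nonneg _) (Finset.mem_range.2 (by omega))
    rw [dyadicSquares_succ]
    push_cast
    simp only [mul_zero] at h1
    set a := u (2 * (j / 2)) - u 0
    set b := u j - u (2 * (j / 2))
    set T := dyadicSquares (fun q => u (2 * q)) s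
    set D := ∑ q ∈ Finset.range (2 ^ (s + 1)), (u (q + 1) - u q) ^ 2
    have hab : u j - u 0 = a + b := by simp only [a, b]; ring
    rw [hab]
    have hs : (0 : ℝ) < s + 1 := by positivity
    -- Weighted Cauchy–Schwarz: the two sides differ by (a - (s+1)b)^2. The weights make the factor
    -- grow by only one per level.
    have key : (s + 1) * (a + b) ^ 2 ≤ (s + 2) * (a ^ 2 + (s + 1) * b ^ 2) := by
      nlinarith [sq_nonneg (a - (s + 1) * b)]
    have : (s + 1) * (a + b) ^ 2 ≤ (s + 1) * ((s + 1 + 1) * (T + D)) := by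
      have : (s + 2) * (a ^ 2 + (s + 1) * b ^ 2) ≤ (s + 2) * ((s + 1) * T + (s + 1) * D) := by
        gcongr
      linarith
    exact le_of_mul_le_mul_left this hs

/-- The diagonal blocks are disjoint parts of one square. Nonnegativity is essential, which is why
positive parts of covariances are summed: every dyadic level is then bounded by the same total. -/
theorem sum_blocks_le {c : ℕ → ℕ → ℝ} (hc : ∀ i j, 0 ≤ c i j) {m : ℕ → ℕ} (hm : Monotone m)
    (Q : ℕ) :
    ∑ q ∈ Finset.range Q, ∑ i ∈ Finset.Ioc (m q) (m (q + 1)), ∑ j ∈ Finset.Ioc (m q) (m (q + 1)),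
      c i j ≤ ∑ i ∈ Finset.Ioc (m 0) (m Q), ∑ j ∈ Finset.Ioc (m 0) (m Q), c i j := by
  induction Q with
  | zero => simp
  | succ Q ih =>
    rw [Finset.sum_range_succ]
    have h0 : m 0 ≤ m Q := hm (Nat.zero_le _)
    have h1 : m Q ≤ m (Q + 1) := hm (Nat.le_succ _)
    have e := Finset.sum_Ioc_consecutive
      (fun i => ∑ j ∈ Finset.Ioc (m 0) (m (Q + 1)), c i j) h0 h1
    rw [← e]
    refine add_le_add (ih.trans ?_) ?_
    · exact Finset.sum_le_sum fun i _ => Finset.sum_le_sum_of_subset_of_nonneg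
        (Finset.Ioc_subset_Ioc_right h1) fun _ _ _ => hc _ _
    · exact Finset.sum_le_sum fun i _ => Finset.sum_le_sum_of_subset_of_nonneg
        (Finset.Ioc_subset_Ioc_left h0) fun _ _ _ => hc _ _

/-! ### Variance bounds and the quantitative strong law. -/

section Abstract

variable {Ω : Type*} [MeasurableSpace Ω] {μ : Measure Ω}

/-- The sum over `1 ≤ i, j ≤ n` of the positive parts of the covariances of `g i` and `g j`. -/
noncomputable def posCovSum (μ : Measure Ω) (g : ℕ → Ω → ℝ) (n : ℕ) : ℝ :=
  ∑ i ∈ Finset.Icc 1 n, ∑ j ∈ Finset.Icc 1 n,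
    max ((∫ x, g i x * g j x ∂μ) - (∫ x, g i x ∂μ) * ∫ x, g j x ∂μ) 0

theorem integral_sum_sub_sq_le [IsProbabilityMeasure μ] {g : ℕ → Ω → ℝ}
    (hg : ∀ k, Integrable (g k) μ)
    (hgg : ∀ i j, Integrable (fun x => g i x * g j x) μ) (s : Finset ℕ) :
    Integrable (fun x => (∑ k ∈ s, (g k x - ∫ y, g k y ∂μ)) ^ 2) μ ∧
    ∫ x, (∑ k ∈ s, (g k x - ∫ y, g k y ∂μ)) ^ 2 ∂μ ≤
      ∑ i ∈ s, ∑ j ∈ s,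
        max ((∫ x, g i x * g j x ∂μ) - (∫ x, g i x ∂μ) * ∫ x, g j x ∂μ) 0 := by
  have e : ∀ x, (∑ k ∈ s, (g k x - ∫ y, g k y ∂μ)) ^ 2 = ∑ i ∈ s, ∑ j ∈ s,
      (g i x * g j x - (∫ y, g i y ∂μ) * g j x - g i x * (∫ y, g j y ∂μ)
        + (∫ y, g i y ∂μ) * ∫ y, g j y ∂μ) := by
    intro x
    rw [sq, Finset.sum_mul_sum]
    exact Finset.sum_congr rfl fun i _ => Finset.sum_congr rfl fun j _ => by ring
  have hi : ∀ i j, Integrable (fun x => g i x * g j x - (∫ y, g i y ∂μ) * g j x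
      - g i x * (∫ y, g j y ∂μ) + (∫ y, g i y ∂μ) * ∫ y, g j y ∂μ) μ := fun i j =>
    ((((hgg i j).sub ((hg j).const_mul _)).sub ((hg i).mul_const _)).add (integrable_const _))
  simp_rw [e]
  refine ⟨integrable_finsetSum _ fun i _ => integrable_finsetSum _ fun j _ => hi i j, ?_⟩
  rw [integral_finsetSum _ fun i _ => integrable_finsetSum _ fun j _ => hi i j]
  refine Finset.sum_le_sum fun i _ => ?_
  rw [integral_finsetSum _ fun j _ => hi i j]
  refine Finset.sum_le_sum fun j _ => le_max_of_le_left (le_of_eq ?_)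
  generalize ha : (∫ y, g i y ∂μ) = a at *
  generalize hb : (∫ y, g j y ∂μ) = b at *
  have h1 : Integrable (fun x => a * g j x) μ := (hg j).const_mul _
  have h2 : Integrable (fun x => g i x * b) μ := (hg i).mul_const _
  have h3 : Integrable (fun x => g i x * g j x - a * g j x) μ := (hgg i j).sub h1
  have h4 : Integrable (fun x => g i x * g j x - a * g j x - g i x * b) μ := h3.sub h2
  rw [integral_add h4 (integrable_const _), integral_sub h3 h2, integral_sub (hgg i j) h1,
    integral_const_mul, integral_mul_const, ha, hb]
  simp

/-- By Tonelli the sum of the `M s` has finite integral, so it is finite almost everywhere and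
dominates each term. -/
theorem ae_exists_bound_of_summable_integral {M : ℕ → Ω → ℝ} (hM : ∀ s, Integrable (M s) μ)
    (h0 : ∀ s x, 0 ≤ M s x) (hs : Summable fun s => ∫ x, M s x ∂μ) :
    ∀ᵐ x ∂μ, ∃ K : ℝ, ∀ s, M s x ≤ K := by
  have h1 : ∫⁻ x, ∑' s, ENNReal.ofReal (M s x) ∂μ ≠ ⊤ := by
    rw [lintegral_tsum fun s => (hM s).aestronglyMeasurable.aemeasurable.ennreal_ofReal]
    have : ∀ s, ∫⁻ x, ENNReal.ofReal (M s x) ∂μ = ENNReal.ofReal (∫ x, M s x ∂μ) := fun s =>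
      (ofReal_integral_eq_lintegral_ofReal (hM s) (ae_of_all _ (h0 s))).symm
    simp_rw [this]
    exact hs.tsum_ofReal_ne_top
  have hmeas : AEMeasurable (fun x => ∑' s, ENNReal.ofReal (M s x)) μ :=
    AEMeasurable.tsum fun s => (hM s).aestronglyMeasurable.aemeasurable.ennreal_ofReal
  filter_upwards [ae_lt_top' hmeas h1] with x hx
  refine ⟨(∑' s, ENNReal.ofReal (M s x)).toReal, fun s => ?_⟩
  rw [← ENNReal.toReal_ofReal (h0 s x)]
  exact ENNReal.toReal_mono hx.ne (ENNReal.le_tsum s)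

end Abstract

/-- For a partial-sum sequence with increments at most `1` tending to infinity, the first times
at which it reaches the natural numbers. -/
theorem exists_unit_partition {e : ℕ → ℝ} (h1 : ∀ k, e k ≤ 1)
    (hE : Tendsto (fun n => ∑ k ∈ Finset.Icc 1 n, e k) atTop atTop) :
    ∃ m : ℕ → ℕ, Monotone m ∧ m 0 = 0 ∧
      (∀ q : ℕ, (q : ℝ) ≤ ∑ k ∈ Finset.Icc 1 (m q), e k ∧
        ∑ k ∈ Finset.Icc 1 (m q), e k ≤ q + 1) ∧
      (∀ q n : ℕ, (q : ℝ) ≤ ∑ k ∈ Finset.Icc 1 n, e k → m q ≤ n) := by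
  classical
  have hex : ∀ q : ℕ, ∃ n, (q : ℝ) ≤ ∑ k ∈ Finset.Icc 1 n, e k := fun q =>
    (hE.eventually_ge_atTop (q : ℝ)).exists
  refine ⟨fun q => Nat.find (hex q), ?_, ?_, fun q => ⟨Nat.find_spec (hex q), ?_⟩,
    fun q n h => Nat.find_min' _ h⟩
  · intro p q hpq
    exact Nat.find_min' _ (le_trans (by exact_mod_cast hpq) (Nat.find_spec (hex q)))
  · exact Nat.le_zero.1 (Nat.find_min' _ (by simp))
  · change ∑ k ∈ Finset.Icc 1 (Nat.find (hex q)), e k ≤ q + 1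
    generalize hn : Nat.find (hex q) = n
    cases n with
    | zero => simpa using (by positivity : (0 : ℝ) ≤ (q : ℝ) + 1)
    | succ n =>
      have h := Nat.find_min (hex q) (m := n) (by omega)
      rw [Finset.sum_Icc_succ_top (by omega)]
      linarith [h1 (n + 1)]

section Abstract

variable {Ω : Type*} [MeasurableSpace Ω] {μ : Measure Ω}

/-- Rademacher–Menshov: the expected dyadic square sum along a subsequence of times. -/
theorem integral_dyadicSquares_le [IsProbabilityMeasure μ] {g : ℕ → Ω → ℝ}
    (hg : ∀ k, Integrable (g k) μ) (hgg : ∀ i j, Integrable (fun x => g i x * g j x) μ)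
    {m : ℕ → ℕ} (hm : Monotone m) (h0 : m 0 = 0) (s : ℕ) :
    Integrable (fun x => dyadicSquares
      (fun q => ∑ k ∈ Finset.Icc 1 (m q), (g k x - ∫ y, g k y ∂μ)) s) μ ∧
    ∫ x, dyadicSquares (fun q => ∑ k ∈ Finset.Icc 1 (m q), (g k x - ∫ y, g k y ∂μ)) s ∂μ
      ≤ (s + 1) * posCovSum μ g (m (2 ^ s)) := by
  have hIcc : ∀ n, Finset.Icc 1 n = Finset.Ioc 0 n := fun n => by ext; simp; omega
  have hdiff : ∀ a b, a ≤ b → ∀ x, (∑ k ∈ Finset.Icc 1 b, (g k x - ∫ y, g k y ∂μ))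
      - ∑ k ∈ Finset.Icc 1 a, (g k x - ∫ y, g k y ∂μ)
      = ∑ k ∈ Finset.Ioc a b, (g k x - ∫ y, g k y ∂μ) := by
    intro a b hab x
    rw [hIcc, hIcc, ← Finset.sum_Ioc_consecutive _ (Nat.zero_le a) hab]
    ring
  have hmon : ∀ l q : ℕ, m (q * 2 ^ l) ≤ m ((q + 1) * 2 ^ l) := fun l q =>
    hm (Nat.mul_le_mul_right _ (Nat.le_succ q))
  unfold dyadicSquares
  simp_rw [hdiff _ _ (hmon _ _)]
  have hint := fun l q : ℕ =>
    integral_sum_sub_sq_le (μ := μ) hg hgg (Finset.Ioc (m (q * 2 ^ l)) (m ((q + 1) * 2 ^ l)))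
  refine ⟨integrable_finsetSum _ fun l _ => integrable_finsetSum _ fun q _ => (hint l q).1, ?_⟩
  rw [integral_finsetSum _ fun l _ => integrable_finsetSum _ fun q _ => (hint l q).1]
  have : ((s : ℝ) + 1) * posCovSum μ g (m (2 ^ s))
      = ∑ _l ∈ Finset.range (s + 1), posCovSum μ g (m (2 ^ s)) := by simp
  rw [this]
  refine Finset.sum_le_sum fun l hl => ?_
  rw [integral_finsetSum _ fun q _ => (hint l q).1]
  refine (Finset.sum_le_sum fun q _ => (hint l q).2).trans ?_
  refine (sum_blocks_le (m := fun q => m (q * 2 ^ l)) (fun _ _ => le_max_right _ _)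
    (fun p q hpq => hm (Nat.mul_le_mul_right _ hpq)) _).trans ?_
  have hl' : l ≤ s := Nat.lt_succ_iff.1 (Finset.mem_range.1 hl)
  rw [← pow_add, Nat.sub_add_cancel hl', zero_mul, h0, ← hIcc, posCovSum]

/-- A quantitative strong law for a fixed exponent. -/
theorem ae_isBigO_rpow_of_posCovSum_le [IsProbabilityMeasure μ] {g : ℕ → Ω → ℝ}
    (hgm : ∀ k, Measurable (g k)) (hg0 : ∀ k x, 0 ≤ g k x) (hg1 : ∀ k x, g k x ≤ 1)
    (hE : Tendsto (fun n => ∑ k ∈ Finset.Icc 1 n, ∫ x, g k x ∂μ) atTop atTop)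
    {b C : ℝ} (hb : 0 ≤ b) (hA : ∀ᶠ n in atTop, posCovSum μ g n
      ≤ C * (∑ k ∈ Finset.Icc 1 n, ∫ x, g k x ∂μ) ^ (2 * b)) {β : ℝ} (hβ : b < β) :
    ∀ᵐ x ∂μ, (fun n => ∑ k ∈ Finset.Icc 1 n, g k x - ∑ k ∈ Finset.Icc 1 n, ∫ x, g k x ∂μ)
      =O[atTop] fun n => (∑ k ∈ Finset.Icc 1 n, ∫ x, g k x ∂μ) ^ β := by
  have hg : ∀ k, Integrable (g k) μ := fun k =>
    Integrable.of_bound (hgm k).aestronglyMeasurable 1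
      (ae_of_all _ fun x => by rw [Real.norm_of_nonneg (hg0 k x)]; exact hg1 k x)
  have hgg : ∀ i j, Integrable (fun x => g i x * g j x) μ := fun i j =>
    Integrable.of_bound ((hgm i).mul (hgm j)).aestronglyMeasurable 1
      (ae_of_all _ fun x => by
        rw [Real.norm_of_nonneg (mul_nonneg (hg0 i x) (hg0 j x))]
        exact mul_le_one₀ (hg1 i x) (hg0 j x) (hg1 j x))
  have he0 : ∀ k, 0 ≤ ∫ x, g k x ∂μ := fun k => integral_nonneg (hg0 k)
  have he1 : ∀ k, ∫ x, g k x ∂μ ≤ 1 := fun k => by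
    simpa using integral_mono (hg k) (integrable_const (μ := μ) (1 : ℝ)) (hg1 k)
  obtain ⟨m, hm, hm0, hmq, hmle⟩ := exists_unit_partition he1 hE
  set e : ℕ → ℝ := fun k => ∫ x, g k x ∂μ with he
  set EE : ℕ → ℝ := fun n => ∑ k ∈ Finset.Icc 1 n, e k with hEE
  have hmtop : Tendsto m atTop atTop := by
    refine tendsto_atTop_mono' atTop (f₁ := fun q : ℕ => q - 1) ?_
      (tendsto_sub_atTop_nat 1)
    filter_upwards with q
    have h := (hmq q).1
    have h2 : ∑ k ∈ Finset.Icc 1 (m q), e k ≤ m q := by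
      simpa using Finset.sum_le_card_nsmul (Finset.Icc 1 (m q)) e 1 fun k _ => he1 k
    have : q ≤ m q := by exact_mod_cast h.trans h2
    omega
  have hβ0 : 0 < β := hb.trans_lt hβ
  set ρ : ℝ := 2 ^ (2 * b - 2 * β) with hρ
  have hρ0 : 0 < ρ := by positivity
  have hρ1 : ρ < 1 := Real.rpow_lt_one_of_one_lt_of_neg (by norm_num) (by linarith)
  -- `M s` is the chaining bound at scale E ≈ 2^s, normalised by the square of the desired error.
  -- Its mean is O((s+1)^2 ρ^s), and ρ < 1 exactly because β > b.
  let M : ℕ → Ω → ℝ := fun s x => ((2 : ℝ) ^ s) ^ (-(2 * β)) * ((s + 1) * dyadicSquares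
      (fun q => ∑ k ∈ Finset.Icc 1 (m q), (g k x - e k)) s)
  have hMi : ∀ s, Integrable (M s) μ := fun s =>
    ((integral_dyadicSquares_le hg hgg hm hm0 s).1.const_mul _).const_mul _
  have hM0 : ∀ s x, 0 ≤ M s x := fun s x => by
    have := dyadicSquares_nonneg (fun q => ∑ k ∈ Finset.Icc 1 (m q), (g k x - e k)) s
    positivity
  have hMs : Summable fun s => ∫ x, M s x ∂μ := by
    have hsum : Summable fun s : ℕ => |C| * 2 ^ (2 * b) * (((s : ℝ) + 1) ^ 2 * ρ ^ s) := by
      refine Summable.mul_left _ ?_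
      have hn : ‖ρ‖ < 1 := by rwa [Real.norm_of_nonneg hρ0.le]
      have a2 := summable_pow_mul_geometric_of_norm_lt_one 2 hn
      have a1 := summable_pow_mul_geometric_of_norm_lt_one 1 hn
      have a0 := summable_pow_mul_geometric_of_norm_lt_one 0 hn
      refine ((a2.add (a1.mul_left 2)).add a0).congr fun s => ?_
      simp only [pow_zero, pow_one]
      ring
    refine Summable.of_norm_bounded_eventually_nat hsum ?_
    have hpow : Tendsto (fun s : ℕ => m (2 ^ s)) atTop atTop :=
      hmtop.comp (tendsto_pow_atTop_atTop_of_one_lt one_lt_two)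
    filter_upwards [hpow.eventually hA] with s hs
    rw [Real.norm_of_nonneg (integral_nonneg (hM0 s))]
    have i1 : ∫ x, M s x ∂μ ≤ ((2 : ℝ) ^ s) ^ (-(2 * β)) *
        ((s + 1) * ((s + 1) * posCovSum μ g (m (2 ^ s)))) := by
      simp only [M]
      rw [integral_const_mul, integral_const_mul]
      have := (integral_dyadicSquares_le hg hgg hm hm0 s).2
      gcongr
    have i2 : posCovSum μ g (m (2 ^ s)) ≤ |C| * (2 ^ (2 * b) * ((2 : ℝ) ^ s) ^ (2 * b)) := by
      refine hs.trans ?_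
      rw [← Real.mul_rpow (by positivity) (by positivity)]
      have hnn : 0 ≤ ∑ k ∈ Finset.Icc 1 (m (2 ^ s)), e k := Finset.sum_nonneg fun k _ => he0 k
      have hle : ∑ k ∈ Finset.Icc 1 (m (2 ^ s)), e k ≤ 2 * 2 ^ s := by
        have h := (hmq (2 ^ s)).2
        push_cast at h
        have : (1 : ℝ) ≤ 2 ^ s := one_le_pow₀ (by norm_num)
        linarith
      gcongr
      exact le_abs_self C
    refine i1.trans ?_
    have i3 : ((2 : ℝ) ^ s) ^ (-(2 * β)) * ((2 : ℝ) ^ s) ^ (2 * b) = ρ ^ s := by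
      rw [← Real.rpow_add (by positivity), hρ, ← Real.rpow_natCast, ← Real.rpow_natCast,
        ← Real.rpow_mul (by norm_num), ← Real.rpow_mul (by norm_num)]
      congr 1
      ring
    calc _ ≤ ((2 : ℝ) ^ s) ^ (-(2 * β)) * ((s + 1) * ((s + 1) *
            (|C| * (2 ^ (2 * b) * ((2 : ℝ) ^ s) ^ (2 * b))))) := by gcongr
      _ = |C| * 2 ^ (2 * b) * ((s + 1) ^ 2 *
            (((2 : ℝ) ^ s) ^ (-(2 * β)) * ((2 : ℝ) ^ s) ^ (2 * b))) := by ring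
      _ = _ := by rw [i3]
  filter_upwards [ae_exists_bound_of_summable_integral hMi hM0 hMs] with x hx
  obtain ⟨K, hK⟩ := hx
  have hK0 : 0 ≤ K := (hM0 0 x).trans (hK 0)
  set u : ℕ → ℝ := fun n => ∑ k ∈ Finset.Icc 1 n, (g k x - e k) with hu
  have hu0 : u (m 0) = 0 := by simp [hu, hm0]
  have hbound : ∀ q : ℕ, 1 ≤ q → |u (m q)| ≤ √K * (2 * q) ^ β := by
    intro q hq
    -- A dyadic level with q ≤ 2^s ≤ 2q.
    set s := Nat.log 2 q + 1
    have hq1 : q ≤ 2 ^ s := (Nat.lt_pow_succ_log_self one_lt_two q).le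
    have hq2 : (2 : ℝ) ^ s ≤ 2 * q := by
      have := Nat.pow_log_le_self 2 (x := q) (by omega)
      rw [pow_succ]
      have h' : (2 : ℝ) ^ Nat.log 2 q ≤ q := by exact_mod_cast this
      linarith
    have h1 := sq_sub_le_dyadicSquares s (fun q => u (m q)) q hq1
    simp only [hu0, sub_zero] at h1
    have h2 : ((s : ℝ) + 1) * dyadicSquares (fun q => u (m q)) s
        ≤ K * ((2 : ℝ) ^ s) ^ (2 * β) := by
      have h3 : ((2 : ℝ) ^ s) ^ (-(2 * β)) *
        (((s : ℝ) + 1) * dyadicSquares (fun q => u (m q)) s) ≤ K := hK s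
      rw [Real.rpow_neg (by positivity)] at h3
      rwa [inv_mul_le_iff₀ (by positivity), mul_comm _ K] at h3
    have h4 : u (m q) ^ 2 ≤ (√K * (2 * q) ^ β) ^ 2 := by
      refine (h1.trans h2).trans ?_
      rw [mul_pow, Real.sq_sqrt hK0, ← Real.rpow_natCast ((2 * (q : ℝ)) ^ β),
        ← Real.rpow_mul (by positivity)]
      push_cast
      rw [mul_comm β 2]
      gcongr
    exact abs_le_of_sq_le_sq h4 (by positivity)
  have hSu : ∀ n, ∑ k ∈ Finset.Icc 1 n, g k x - ∑ k ∈ Finset.Icc 1 n, e k = u n := fun n => by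
    simp [hu, Finset.sum_sub_distrib]
  -- Both sums are monotone in n, so n is squeezed between `m q` and `m (q + 1)` with q = ⌊E_n⌋. The
  -- factor 4 comes from 2(q + 1) ≤ 4 E_n; the summand 2 covers the change of E between these times
  -- and n.
  refine IsBigO.of_bound (√K * 4 ^ β + 2) ?_
  filter_upwards [hE.eventually_ge_atTop 1] with n hn
  change 1 ≤ EE n at hn
  change ‖∑ k ∈ Finset.Icc 1 n, g k x - ∑ k ∈ Finset.Icc 1 n, e k‖ ≤ _ * ‖EE n ^ β‖
  set q := ⌊EE n⌋₊ with hq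
  have hqE : (q : ℝ) ≤ EE n := Nat.floor_le (by linarith)
  have hEq : EE n < q + 1 := Nat.lt_floor_add_one _
  have hq1 : 1 ≤ q := Nat.le_floor (by simpa using hn)
  have hle1 : m q ≤ n := hmle q n hqE
  have hle2 : n ≤ m (q + 1) := by
    by_contra hlt
    have : EE (m (q + 1)) ≤ EE n := Finset.sum_le_sum_of_subset_of_nonneg
      (Finset.Icc_subset_Icc_right (by omega)) fun k _ _ => he0 k
    have h2 := (hmq (q + 1)).1
    push_cast at h2
    change (q : ℝ) + 1 ≤ EE (m (q + 1)) at h2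
    linarith
  have hS1 : ∑ k ∈ Finset.Icc 1 (m q), g k x ≤ ∑ k ∈ Finset.Icc 1 n, g k x :=
    Finset.sum_le_sum_of_subset_of_nonneg (Finset.Icc_subset_Icc_right hle1) fun k _ _ => hg0 k x
  have hS2 : ∑ k ∈ Finset.Icc 1 n, g k x ≤ ∑ k ∈ Finset.Icc 1 (m (q + 1)), g k x :=
    Finset.sum_le_sum_of_subset_of_nonneg (Finset.Icc_subset_Icc_right hle2) fun k _ _ => hg0 k x
  have e1 : (q : ℝ) ≤ EE (m q) := (hmq q).1
  have e2 : EE (m (q + 1)) ≤ q + 1 + 1 := by simpa using (hmq (q + 1)).2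
  have b1 := hbound q hq1
  have b2 := hbound (q + 1) (by omega)
  have s1 : _ - EE (m q) = _ := hSu (m q)
  have s2 : _ - EE (m (q + 1)) = _ := hSu (m (q + 1))
  have hpow1 : (2 * (q : ℝ)) ^ β ≤ 4 ^ β * EE n ^ β := by
    rw [← Real.mul_rpow (by norm_num) (by linarith)]
    exact Real.rpow_le_rpow (by positivity) (by linarith) hβ0.le
  have hpow2 : (2 * ((q + 1 : ℕ) : ℝ)) ^ β ≤ 4 ^ β * EE n ^ β := by
    rw [← Real.mul_rpow (by norm_num) (by linarith)]
    refine Real.rpow_le_rpow (by positivity) ?_ hβ0.le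
    push_cast
    linarith
  have hone : 1 ≤ EE n ^ β := Real.one_le_rpow hn hβ0.le
  have c1 := b1.trans (mul_le_mul_of_nonneg_left hpow1 (Real.sqrt_nonneg K))
  have c2 := b2.trans (mul_le_mul_of_nonneg_left hpow2 (Real.sqrt_nonneg K))
  rw [abs_le] at c1 c2
  rw [Real.norm_of_nonneg (show 0 ≤ EE n ^ β by linarith), Real.norm_eq_abs, abs_le]
  change _ ≤ _ - EE n ∧ _ - EE n ≤ _
  have hex : (√K * 4 ^ β + 2) * EE n ^ β = √K * (4 ^ β * EE n ^ β) + 2 * EE n ^ β := by ring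
  have hEm : EE (m q) ≤ q + 1 := (hmq q).2
  constructor <;> linarith [c1.1, c2.2]

/-- A quantitative strong law, in the style of Gál–Koksma and Sprindžuk. -/
theorem ae_forall_isBigO_rpow_of_posCovSum_le [IsProbabilityMeasure μ] {g : ℕ → Ω → ℝ}
    (hgm : ∀ k, Measurable (g k)) (hg0 : ∀ k x, 0 ≤ g k x) (hg1 : ∀ k x, g k x ≤ 1)
    (hE : Tendsto (fun n => ∑ k ∈ Finset.Icc 1 n, ∫ x, g k x ∂μ) atTop atTop)
    {b C : ℝ} (hb : 0 ≤ b) (hA : ∀ᶠ n in atTop, posCovSum μ g n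
      ≤ C * (∑ k ∈ Finset.Icc 1 n, ∫ x, g k x ∂μ) ^ (2 * b)) :
    ∀ᵐ x ∂μ, ∀ β : ℝ, b < β →
      (fun n => ∑ k ∈ Finset.Icc 1 n, g k x - ∑ k ∈ Finset.Icc 1 n, ∫ x, g k x ∂μ)
        =O[atTop] fun n => (∑ k ∈ Finset.Icc 1 n, ∫ x, g k x ∂μ) ^ β := by
  -- Countably many exponents decreasing to b give one null set valid for all β.
  have h : ∀ᵐ x ∂μ, ∀ p : ℕ, (fun n => ∑ k ∈ Finset.Icc 1 n, g k x
      - ∑ k ∈ Finset.Icc 1 n, ∫ x, g k x ∂μ)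
        =O[atTop] fun n => (∑ k ∈ Finset.Icc 1 n, ∫ x, g k x ∂μ) ^ (b + 1 / ((p : ℝ) + 1)) :=
    ae_all_iff.2 fun p => ae_isBigO_rpow_of_posCovSum_le hgm hg0 hg1 hE hb hA
      (lt_add_of_pos_right _ (by positivity))
  filter_upwards [h] with x hx β hβ
  obtain ⟨p, hp⟩ := exists_nat_one_div_lt (sub_pos.2 hβ)
  refine (hx p).trans (IsBigO.of_bound 1 ?_)
  filter_upwards [hE.eventually_ge_atTop 1] with n hn
  rw [one_mul, Real.norm_of_nonneg (by positivity), Real.norm_of_nonneg (by positivity)]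
  exact Real.rpow_le_rpow_of_exponent_le hn (by linarith)

end Abstract

/-! ### Consequences of annulus regularity at the centre. -/

section Regularity

variable {X : Type*} [MetricSpace X] [MeasurableSpace X]

/-- The ratio 2/3 splits a radius s into an inner radius 2s/3 and a width s/3, so the condition ε <
r of `AnnulusRegular` holds at every step. -/
theorem le_iterate_of_le_two_thirds {h : ℝ → ℝ} {R : ℝ}
    (hh : ∀ s, 0 < s → s < R → h s ≤ h (s * (2 / 3))) (n : ℕ) :
    ∀ s, 0 < s → s < R → h s ≤ h (s * (2 / 3) ^ n) := by
  induction n with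
  | zero => simp
  | succ n ih =>
    intro s hs hsR
    have h1 := hh s hs hsR
    have h2 := ih (s * (2 / 3)) (by positivity) (by linarith)
    rw [pow_succ', ← mul_assoc]
    exact h1.trans h2

theorem exists_measureReal_ball_iterate_lt {ν : Measure X} [IsFiniteMeasure ν] {c : X}
    (hsmall : ∀ η : ℝ, 0 < η → ∃ ρ : ℝ, 0 < ρ ∧ ν.real (Metric.ball c ρ) < η)
    {s η : ℝ} (hη : 0 < η) :
    ∃ n : ℕ, ν.real (Metric.ball c (s * (2 / 3) ^ n)) < η := by
  obtain ⟨ρ, hρ, hlt⟩ := hsmall η hη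
  have ht : Tendsto (fun n : ℕ => s * (2 / 3 : ℝ) ^ n) atTop (𝓝 0) := by
    simpa using (tendsto_pow_atTop_nhds_zero_of_lt_one (r := (2 / 3 : ℝ))
      (by norm_num) (by norm_num)).const_mul s
  obtain ⟨n, hn⟩ := (ht.eventually_lt_const hρ).exists
  exact ⟨n, (measureReal_mono (Metric.ball_subset_ball hn.le)).trans_lt hlt⟩

/-- The measure of small balls about a regular, null centre is at most a power of the radius. -/
theorem AnnulusRegular.exists_measureReal_ball_le_rpow {ν : Measure X} [IsFiniteMeasure ν] {c : X}
    {δ : ℝ} (h : AnnulusRegular ν c δ)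
    (hsmall : ∀ η : ℝ, 0 < η → ∃ ρ : ℝ, 0 < ρ ∧ ν.real (Metric.ball c ρ) < η) :
    ∃ C : ℝ, 0 ≤ C ∧ ∃ R : ℝ, 0 < R ∧ ∀ s, 0 < s → s < R →
      ν.real (Metric.ball c s) ≤ C * s ^ δ := by
  obtain ⟨hδ, R, hR, C, hC⟩ := h
  set κ : ℝ := (2 / 3) ^ δ
  have hκ0 : 0 < κ := by positivity
  have hκ : κ < 1 := Real.rpow_lt_one (by norm_num) (by norm_num) hδ
  have hκ' : 0 < 1 - κ := by linarith
  refine ⟨|C| / (1 - κ), by positivity, R, hR, fun s hs hsR => ?_⟩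
  -- Sum of the geometric series of annulus bounds. With this A, passing from s to 2s/3 does not
  -- decrease ν(B(c, s)) - A s^δ.
  set A := |C| / (1 - κ) with hA
  have hAC : A * (1 - κ) = |C| := by rw [hA]; field_simp
  have step : ∀ s, 0 < s → s < R → ν.real (Metric.ball c s) - A * s ^ δ ≤
      ν.real (Metric.ball c (s * (2 / 3))) - A * (s * (2 / 3)) ^ δ := by
    intro s hs hsR
    have h1 := hC (s / 3) (s * (2 / 3)) (by positivity) (by linarith) (by linarith)
    rw [show s * (2 / 3) + s / 3 = s by ring] at h1
    have h2 := (le_abs_self _).trans h1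
    have h3 : C * (s / 3) ^ δ ≤ |C| * s ^ δ := by
      gcongr
      · exact le_abs_self C
      · linarith
    rw [Real.mul_rpow hs.le (by norm_num)]
    have h4 : A * s ^ δ - A * (s ^ δ * κ) = |C| * s ^ δ := by rw [← hAC]; ring
    change _ ≤ _ - A * (s ^ δ * κ)
    linarith
  refine le_of_forall_pos_le_add fun η hη => ?_
  obtain ⟨n, hn⟩ := exists_measureReal_ball_iterate_lt hsmall (s := s) hη
  have h1 := le_iterate_of_le_two_thirds
    (h := fun s => ν.real (Metric.ball c s) - A * s ^ δ) step n s hs hsR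
  have h2 : 0 ≤ A * (s * (2 / 3) ^ n) ^ δ := by positivity
  linarith

/-- At a regular, null centre, annuli of inner radius smaller than their width are controlled
as well. -/
theorem AnnulusRegular.exists_measureReal_ball_add_le {ν : Measure X} [IsFiniteMeasure ν] {c : X}
    {δ : ℝ} (h : AnnulusRegular ν c δ)
    (hsmall : ∀ η : ℝ, 0 < η → ∃ ρ : ℝ, 0 < ρ ∧ ν.real (Metric.ball c ρ) < η) :
    ∃ C : ℝ, 0 ≤ C ∧ ∃ R : ℝ, 0 < R ∧ ∀ r ε, r < R → 0 < ε → ε < R →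
      ν.real (Metric.ball c (r + ε)) ≤ ν.real (Metric.ball c r) + C * ε ^ δ := by
  obtain ⟨A, hA, R₁, hR₁, h1⟩ := h.exists_measureReal_ball_le_rpow hsmall
  obtain ⟨hδ, R, hR, C, hC⟩ := h
  refine ⟨|C| + A * 2 ^ δ, by positivity, min R (R₁ / 2), by positivity, fun r ε hr hε hεR => ?_⟩
  have hεδ : 0 ≤ ε ^ δ := by positivity
  rcases lt_or_ge ε r with hlt | hge
  · have h2 := (le_abs_self _).trans (hC ε r hε hlt (hr.trans_le (min_le_left _ _)))
    have h3 : C * ε ^ δ ≤ |C| * ε ^ δ := mul_le_mul_of_nonneg_right (le_abs_self C) hεδ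
    have h4 : 0 ≤ A * 2 ^ δ * ε ^ δ := by positivity
    linarith
  -- When r ≤ ε the annulus hypothesis is silent, but the whole ball lies in B(c, 2ε), whose measure
  -- is O(ε^δ).
  · have h2 : ν.real (Metric.ball c (r + ε)) ≤ ν.real (Metric.ball c (2 * ε)) :=
      measureReal_mono (Metric.ball_subset_ball (by linarith))
    have h3 := h1 (2 * ε) (by positivity) (by linarith [hεR.trans_le (min_le_right _ _)])
    rw [Real.mul_rpow (by norm_num) hε.le] at h3
    have h4 : 0 ≤ |C| * ε ^ δ := by positivity
    have h5 : 0 ≤ ν.real (Metric.ball c r) := measureReal_nonneg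
    linarith

/-- The annulus regularity exponent at a null centre in the support is at most `1`. -/
theorem AnnulusRegular.exponent_le_one {ν : Measure X} [IsFiniteMeasure ν] {c : X}
    {δ : ℝ} (h : AnnulusRegular ν c δ) (hpos : ∀ r, 0 < r → 0 < ν.real (Metric.ball c r))
    (hsmall : ∀ η : ℝ, 0 < η → ∃ ρ : ℝ, 0 < ρ ∧ ν.real (Metric.ball c ρ) < η) : δ ≤ 1 := by
  by_contra! hδ1
  obtain ⟨hδ, R, hR, C, hC⟩ := h
  have step : ∀ s, 0 < s → s < R →
      ν.real (Metric.ball c s) ≤ ν.real (Metric.ball c (s * (2 / 3))) := by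
    intro s hs hsR
    set r := s * (2 / 3) with hr
    have hr0 : 0 < r := by positivity
    -- Cutting the annulus into N + 1 thinner ones of width w costs (N+1) C w^δ, which tends to 0
    -- when δ > 1. The annulus would then be null.
    have key : ∀ N : ℕ, ν.real (Metric.ball c s) ≤ ν.real (Metric.ball c r)
        + (C * (s / 3) ^ δ) * ((N : ℝ) + 1) ^ (-(δ - 1)) := by
      intro N
      set w := s / 3 / (N + 1) with hw
      have hw0 : 0 < w := by positivity
      have hws : w ≤ s / 3 := div_le_self (by positivity) (by linarith [N.cast_nonneg (α := ℝ)])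
      have hwN : (N + 1) * w = s / 3 := by rw [hw]; field_simp
      have ind : ∀ i : ℕ, i ≤ N + 1 → ν.real (Metric.ball c (r + i * w)) ≤
          ν.real (Metric.ball c r) + i * (C * w ^ δ) := by
        intro i
        induction i with
        | zero => simp
        | succ i ih =>
          intro hi
          have hiN : (i : ℝ) + 1 ≤ N + 1 := by exact_mod_cast hi
          have h0 : 0 ≤ (i : ℝ) * w := by positivity
          have h3 : ((i : ℝ) + 1) * w ≤ (N + 1) * w := by gcongr
          have h1 := hC w (r + i * w) hw0 (by linarith) (by linarith)
          have h2 := (le_abs_self _).trans h1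
          have := ih (by omega)
          push_cast
          rw [show r + ((i : ℝ) + 1) * w = r + i * w + w by ring]
          linarith
      have h1 := ind (N + 1) le_rfl
      push_cast at h1
      rw [hwN, show r + s / 3 = s by rw [hr]; ring] at h1
      refine h1.trans (le_of_eq ?_)
      have hN : (0 : ℝ) < N + 1 := by positivity
      rw [hw, Real.div_rpow (by positivity) hN.le, neg_sub, Real.rpow_sub hN, Real.rpow_one]
      field_simp
    have ht : Tendsto (fun N : ℕ => ν.real (Metric.ball c r)
        + (C * (s / 3) ^ δ) * ((N : ℝ) + 1) ^ (-(δ - 1))) atTop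
        (𝓝 (ν.real (Metric.ball c r) + (C * (s / 3) ^ δ) * 0)) :=
      tendsto_const_nhds.add (((tendsto_rpow_neg_atTop (by linarith)).comp
        (tendsto_atTop_add_const_right _ _ tendsto_natCast_atTop_atTop)).const_mul _)
    rw [mul_zero, add_zero] at ht
    exact ge_of_tendsto' ht key
  -- Null annuli at all scales would keep the measure of B(c, R/2) on arbitrarily small balls.
  obtain ⟨n, hn⟩ := exists_measureReal_ball_iterate_lt hsmall (s := R / 2) (hpos (R / 2) (by linarith))
  exact absurd (le_iterate_of_le_two_thirds (h := fun s => ν.real (Metric.ball c s)) step n (R / 2)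
    (by linarith) (by linarith)) (not_le.2 hn)

end Regularity

/-! ### Lipschitz cutoffs of balls. -/

section Cutoff

variable {X : Type*} [MetricSpace X]

/-- The Lipschitz cutoff equal to `1` on `B(c, r)` and to `0` off `B(c, r + ε)`. -/
noncomputable def ballCutoff (c : X) (r ε : ℝ) (x : X) : ℝ :=
  max 0 (min 1 (1 - (dist x c - r) / ε))

theorem ballCutoff_nonneg (c : X) (r ε : ℝ) (x : X) : 0 ≤ ballCutoff c r ε x := le_max_left _ _

theorem ballCutoff_le_one (c : X) (r ε : ℝ) (x : X) : ballCutoff c r ε x ≤ 1 :=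
  max_le zero_le_one (min_le_left _ _)

theorem indicator_ball_le_ballCutoff (c : X) (r : ℝ) {ε : ℝ} (hε : 0 < ε) (x : X) :
    (Metric.ball c r).indicator (fun _ => (1 : ℝ)) x ≤ ballCutoff c r ε x := by
  by_cases hx : x ∈ Metric.ball c r
  · rw [Set.indicator_of_mem hx]
    rw [Metric.mem_ball] at hx
    have : (dist x c - r) / ε ≤ 0 := div_nonpos_of_nonpos_of_nonneg (by linarith) hε.le
    exact le_max_of_le_right (le_min le_rfl (by linarith))
  · rw [Set.indicator_of_notMem hx]
    exact ballCutoff_nonneg c r ε x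

theorem ballCutoff_le_indicator_ball (c : X) (r : ℝ) {ε : ℝ} (hε : 0 < ε) (x : X) :
    ballCutoff c r ε x ≤ (Metric.ball c (r + ε)).indicator (fun _ => (1 : ℝ)) x := by
  by_cases hx : x ∈ Metric.ball c (r + ε)
  · rw [Set.indicator_of_mem hx]
    exact ballCutoff_le_one c r ε x
  · rw [Set.indicator_of_notMem hx]
    rw [Metric.mem_ball, not_lt] at hx
    have : 1 ≤ (dist x c - r) / ε := by rw [le_div_iff₀ hε]; linarith
    exact max_le le_rfl ((min_le_right _ _).trans (by linarith))

theorem abs_ballCutoff_sub_le (c : X) (r : ℝ) {ε : ℝ} (hε : 0 < ε) (x y : X) :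
    |ballCutoff c r ε x - ballCutoff c r ε y| ≤ 1 / ε * dist x y := by
  have h1 : ∀ a b : ℝ, |max 0 (min 1 a) - max 0 (min 1 b)| ≤ |a - b| := fun a b =>
    (abs_max_sub_max_le_max 0 _ 0 _).trans (by
      rw [sub_self, abs_zero, max_eq_right (abs_nonneg _)]
      refine (abs_min_sub_min_le_max 1 a 1 b).trans ?_
      rw [sub_self, abs_zero, max_eq_right (abs_nonneg _)])
  refine (h1 _ _).trans ?_
  rw [show 1 - (dist x c - r) / ε - (1 - (dist y c - r) / ε)
    = -(1 / ε * (dist x c - dist y c)) by ring, abs_neg, abs_mul,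
    abs_of_pos (by positivity : 0 < 1 / ε)]
  gcongr
  exact abs_dist_sub_le x y c

theorem isBddLipschitz_ballCutoff (c : X) (r : ℝ) {ε : ℝ} (hε : 0 < ε) :
    IsBddLipschitz (ballCutoff c r ε) := by
  refine ⟨⟨⟨1 / ε, by positivity⟩, LipschitzWith.of_dist_le_mul fun x y => ?_⟩, 1, fun x => ?_⟩
  · exact abs_ballCutoff_sub_le c r hε x y
  · rw [abs_of_nonneg (ballCutoff_nonneg c r ε x)]
    exact ballCutoff_le_one c r ε x

theorem lipNorm_nonneg (φ : X → ℝ) : 0 ≤ lipNorm φ :=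
  add_nonneg (Real.iSup_nonneg fun _ => abs_nonneg _)
    (Real.iSup_nonneg fun _ => div_nonneg (abs_nonneg _) dist_nonneg)

/-- The slope is at most 1/ε, and ε ≤ 1 lets the supremum 1 be absorbed into another 1/ε. -/
theorem lipNorm_ballCutoff_le (c : X) (r : ℝ) {ε : ℝ} (hε : 0 < ε) (hε1 : ε ≤ 1) :
    lipNorm (ballCutoff c r ε) ≤ 2 / ε := by
  have : Nonempty X := ⟨c⟩
  have h1 : ⨆ x, |ballCutoff c r ε x| ≤ 1 := ciSup_le fun x => by
    rw [abs_of_nonneg (ballCutoff_nonneg c r ε x)]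
    exact ballCutoff_le_one c r ε x
  have h2 : ⨆ p : X × X, |ballCutoff c r ε p.1 - ballCutoff c r ε p.2| / dist p.1 p.2 ≤ 1 / ε :=
    ciSup_le fun p => div_le_of_le_mul₀ dist_nonneg (by positivity)
      (abs_ballCutoff_sub_le c r hε p.1 p.2)
  have h3 : 1 ≤ 1 / ε := by rw [le_div_iff₀ hε]; linarith
  have h4 : 2 / ε = 1 / ε + 1 / ε := by ring
  unfold lipNorm
  linarith

end Cutoff

theorem integrable_of_mem_unit {Ω : Type*} [MeasurableSpace Ω] {ν : Measure Ω} [IsFiniteMeasure ν] {φ : Ω → ℝ} (hm : Measurable φ)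
    (h0 : ∀ x, 0 ≤ φ x) (h1 : ∀ x, φ x ≤ 1) : Integrable φ ν :=
  Integrable.of_bound hm.aestronglyMeasurable 1
    (ae_of_all _ fun x => by rw [Real.norm_of_nonneg (h0 x)]; exact h1 x)

/-! ### Covariances of hits. -/

section Covariance

variable {X : Type*} [MetricSpace X]

/-- The indicator of the event `f^k x ∈ B(c, r k)`. -/
noncomputable def hit (f : X → X) (c : X) (r : ℕ → ℝ) (k : ℕ) (x : X) : ℝ :=
  (Metric.ball c (r k)).indicator (fun _ => (1 : ℝ)) (f^[k] x)

theorem hit_nonneg (f : X → X) (c : X) (r : ℕ → ℝ) (k : ℕ) (x : X) : 0 ≤ hit f c r k x :=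
  Set.indicator_nonneg (fun _ _ => zero_le_one) _

theorem hit_le_one (f : X → X) (c : X) (r : ℕ → ℝ) (k : ℕ) (x : X) : hit f c r k x ≤ 1 :=
  Set.indicator_le_self' (fun _ _ => zero_le_one) _

variable [MeasurableSpace X]

theorem DecayOfCorrelations.nonneg {f : X → X} {ν : Measure X} {Θ : ℕ → ℝ}
    (h : DecayOfCorrelations f ν Θ) (k : ℕ) : 0 ≤ Θ k :=
  h.1.le_of_tendsto h.2.1 k

/-- The positive part of the covariance of two hits. -/
noncomputable def posCov (f : X → X) (ν : Measure X) (c : X) (r : ℕ → ℝ) (i j : ℕ) : ℝ :=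
  max ((∫ x, hit f c r i x * hit f c r j x ∂ν)
    - (∫ x, hit f c r i x ∂ν) * ∫ x, hit f c r j x ∂ν) 0

theorem posCov_comm (f : X → X) (ν : Measure X) (c : X) (r : ℕ → ℝ) (i j : ℕ) :
    posCov f ν c r i j = posCov f ν c r j i := by
  simp only [posCov, mul_comm]

theorem posCov_nonneg (f : X → X) (ν : Measure X) (c : X) (r : ℕ → ℝ) (i j : ℕ) :
    0 ≤ posCov f ν c r i j := le_max_right _ _

variable [OpensMeasurableSpace X]

theorem measurable_hit {f : X → X} (hf : Measurable f) (c : X) (r : ℕ → ℝ) (k : ℕ) :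
    Measurable (hit f c r k) :=
  (measurable_const.indicator Metric.isOpen_ball.measurableSet).comp (hf.iterate k)

theorem integral_hit {f : X → X} {ν : Measure X} (hf : MeasurePreserving f ν ν) (c : X)
    (r : ℕ → ℝ) (k : ℕ) : ∫ x, hit f c r k x ∂ν = ν.real (Metric.ball c (r k)) := by
  have hm : Measurable ((Metric.ball c (r k)).indicator fun _ => (1 : ℝ)) :=
    measurable_const.indicator Metric.isOpen_ball.measurableSet
  have h := integral_map (μ := ν) (hf.iterate k).measurable.aemeasurable
    (f := (Metric.ball c (r k)).indicator fun _ => (1 : ℝ)) hm.aestronglyMeasurable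
  rw [(hf.iterate k).map_eq] at h
  rw [show (∫ x, hit f c r k x ∂ν) = _ from h.symm]
  exact integral_indicator_one Metric.isOpen_ball.measurableSet

theorem measurable_ballCutoff (c : X) (r ε : ℝ) : Measurable (ballCutoff c r ε) := by
  have : Continuous (ballCutoff c r ε) := by unfold ballCutoff; fun_prop
  exact this.measurable

/-- Decay of correlations for a pair of balls about the same centre, by Lipschitz approximation
from outside. -/
theorem integral_indicator_ball_mul_le {f : X → X} {ν : Measure X} [IsProbabilityMeasure ν]
    (hf : MeasurePreserving f ν ν) {Θ : ℕ → ℝ} (hΘ : DecayOfCorrelations f ν Θ) (c : X)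
    {a b ε η : ℝ} (hε : 0 < ε) (hε1 : ε ≤ 1)
    (ha : ν.real (Metric.ball c (a + ε)) ≤ ν.real (Metric.ball c a) + η)
    (hb : ν.real (Metric.ball c (b + ε)) ≤ ν.real (Metric.ball c b) + η) (k : ℕ) :
    (∫ x, (Metric.ball c a).indicator (fun _ => (1 : ℝ)) x *
        (Metric.ball c b).indicator (fun _ => (1 : ℝ)) (f^[k] x) ∂ν)
      - ν.real (Metric.ball c a) * ν.real (Metric.ball c b)
    ≤ η * (ν.real (Metric.ball c a) + ν.real (Metric.ball c b)) + η ^ 2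
      + 4 / ε ^ 2 * Θ k := by
  have hmi : ∀ r, Measurable ((Metric.ball c r).indicator fun _ => (1 : ℝ)) := fun r =>
    measurable_const.indicator Metric.isOpen_ball.measurableSet
  have hi0 : ∀ r x, 0 ≤ (Metric.ball c r).indicator (fun _ => (1 : ℝ)) x := fun r x =>
    Set.indicator_nonneg (fun _ _ => zero_le_one) _
  have hi1 : ∀ r x, (Metric.ball c r).indicator (fun _ => (1 : ℝ)) x ≤ 1 := fun r x =>
    Set.indicator_le_self' (fun _ _ => zero_le_one) _
  have hcut : ∀ r, ∫ x, ballCutoff c r ε x ∂ν ≤ ν.real (Metric.ball c (r + ε)) := by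
    intro r
    rw [← integral_indicator_one (μ := ν) Metric.isOpen_ball.measurableSet]
    exact integral_mono (integrable_of_mem_unit (measurable_ballCutoff c r ε)
      (ballCutoff_nonneg c r ε) (ballCutoff_le_one c r ε))
      (integrable_of_mem_unit (hmi _) (hi0 _) (hi1 _))
      (ballCutoff_le_indicator_ball c r hε)
  have h1 : (∫ x, (Metric.ball c a).indicator (fun _ => (1 : ℝ)) x *
        (Metric.ball c b).indicator (fun _ => (1 : ℝ)) (f^[k] x) ∂ν)
      ≤ ∫ x, ballCutoff c a ε x * ballCutoff c b ε (f^[k] x) ∂ν := by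
    refine integral_mono
      (integrable_of_mem_unit ((hmi a).mul ((hmi b).comp (hf.measurable.iterate k))) ?_ ?_)
      (integrable_of_mem_unit ((measurable_ballCutoff c a ε).mul
        ((measurable_ballCutoff c b ε).comp (hf.measurable.iterate k))) ?_ ?_) ?_
    · exact fun x => mul_nonneg (hi0 _ _) (hi0 _ _)
    · exact fun x => mul_le_one₀ (hi1 _ _) (hi0 _ _) (hi1 _ _)
    · exact fun x => mul_nonneg (ballCutoff_nonneg _ _ _ _) (ballCutoff_nonneg _ _ _ _)
    · exact fun x => mul_le_one₀ (ballCutoff_le_one _ _ _ _) (ballCutoff_nonneg _ _ _ _)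
        (ballCutoff_le_one _ _ _ _)
    · exact fun x => mul_le_mul (indicator_ball_le_ballCutoff c a hε _)
        (indicator_ball_le_ballCutoff c b hε _) (hi0 _ _) (ballCutoff_nonneg _ _ _ _)
  have h2 := (le_abs_self _).trans (hΘ.2.2 _ _ (isBddLipschitz_ballCutoff c a hε)
    (isBddLipschitz_ballCutoff c b hε) k)
  have h3 : Θ k * lipNorm (ballCutoff c a ε) * lipNorm (ballCutoff c b ε)
      ≤ Θ k * (2 / ε) * (2 / ε) := by
    have := hΘ.nonneg k
    have := lipNorm_nonneg (ballCutoff c b ε)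
    gcongr <;> exact lipNorm_ballCutoff_le c _ hε hε1
  have h4 : (∫ x, ballCutoff c a ε x ∂ν) * ∫ x, ballCutoff c b ε x ∂ν ≤
      (ν.real (Metric.ball c a) + η) * (ν.real (Metric.ball c b) + η) :=
    mul_le_mul ((hcut a).trans ha) ((hcut b).trans hb) (integral_nonneg (ballCutoff_nonneg c b ε))
      (measureReal_nonneg.trans ha)
  have h5 : Θ k * (2 / ε) * (2 / ε) = 4 / ε ^ 2 * Θ k := by ring
  nlinarith

/-- Invariance under `f^[i]` reduces a pair of times to their difference. -/
theorem integral_hit_mul_hit {f : X → X} {ν : Measure X}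
    (hf : MeasurePreserving f ν ν) (c : X) (r : ℕ → ℝ) (i k : ℕ) :
    ∫ x, hit f c r i x * hit f c r (i + k) x ∂ν =
      ∫ x, (Metric.ball c (r i)).indicator (fun _ => (1 : ℝ)) x *
        (Metric.ball c (r (i + k))).indicator (fun _ => (1 : ℝ)) (f^[k] x) ∂ν := by
  have hmi : ∀ r, Measurable ((Metric.ball c r).indicator fun _ => (1 : ℝ)) := fun r =>
    measurable_const.indicator Metric.isOpen_ball.measurableSet
  have h := integral_map (μ := ν) (hf.iterate i).measurable.aemeasurable
    (f := fun x => (Metric.ball c (r i)).indicator (fun _ => (1 : ℝ)) x *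
        (Metric.ball c (r (i + k))).indicator (fun _ => (1 : ℝ)) (f^[k] x))
    ((hmi _).mul ((hmi _).comp (hf.measurable.iterate k))).aestronglyMeasurable
  rw [(hf.iterate i).map_eq] at h
  rw [h]
  refine integral_congr_ae (ae_of_all _ fun x => ?_)
  simp only [hit]
  rw [← Function.iterate_add_apply, Nat.add_comm k i]

/-- The trivial bound, used for close pairs, where decay of correlations gives nothing useful. -/
theorem posCov_le_left {f : X → X} {ν : Measure X} [IsProbabilityMeasure ν]
    (hf : MeasurePreserving f ν ν) (c : X) (r : ℕ → ℝ) (i j : ℕ) :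
    posCov f ν c r i j ≤ ν.real (Metric.ball c (r i)) := by
  refine max_le ?_ measureReal_nonneg
  rw [integral_hit hf, integral_hit hf]
  have h1 : ∫ x, hit f c r i x * hit f c r j x ∂ν ≤ ∫ x, hit f c r i x ∂ν := by
    have hm := measurable_hit hf.measurable c r
    refine integral_mono (integrable_of_mem_unit ((hm i).mul (hm j)) ?_ ?_)
      (integrable_of_mem_unit (hm i) (hit_nonneg f c r i) (hit_le_one f c r i)) ?_
    · exact fun x => mul_nonneg (hit_nonneg _ _ _ _ _) (hit_nonneg _ _ _ _ _)
    · exact fun x => mul_le_one₀ (hit_le_one _ _ _ _ _) (hit_nonneg _ _ _ _ _)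
        (hit_le_one _ _ _ _ _)
    · exact fun x => mul_le_of_le_one_right (hit_nonneg _ _ _ _ _) (hit_le_one _ _ _ _ _)
  rw [integral_hit hf] at h1
  have h2 : 0 ≤ ν.real (Metric.ball c (r i)) * ν.real (Metric.ball c (r j)) := by positivity
  linarith

theorem sum_sum_symm_le {c : ℕ → ℕ → ℝ} (hc : ∀ i j, 0 ≤ c i j) (hs : ∀ i j, c i j = c j i)
    (s : Finset ℕ) :
    ∑ i ∈ s, ∑ j ∈ s, c i j ≤ 2 * ∑ i ∈ s, ∑ j ∈ s, if i ≤ j then c i j else 0 := by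
  have h : ∑ i ∈ s, ∑ j ∈ s, c i j ≤ ∑ i ∈ s, ∑ j ∈ s, (if i ≤ j then c i j else 0)
      + ∑ i ∈ s, ∑ j ∈ s, (if j ≤ i then c j i else 0) := by
    rw [← Finset.sum_add_distrib]
    refine Finset.sum_le_sum fun i _ => ?_
    rw [← Finset.sum_add_distrib]
    refine Finset.sum_le_sum fun j _ => ?_
    have h1 := hc i j
    have h2 := hs i j
    split_ifs <;> linarith
  rw [Finset.sum_comm (f := fun i j => if j ≤ i then c j i else 0)] at h
  linarith

theorem sum_shifted_tail_le {Θ : ℕ → ℝ} (hΘ : ∀ k, 0 ≤ Θ k) (n G i : ℕ) :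
    (∑ j ∈ Finset.Icc 1 n, if i + G < j then Θ (j - i) else 0) ≤ ∑ k ∈ Finset.Ioc G n, Θ k := by
  rw [← Finset.sum_filter]
  have hsub : (Finset.Icc 1 n).filter (fun j => i + G < j)
      ⊆ (Finset.Ioc G n).image (fun k => i + k) := by
    intro j hj
    simp only [Finset.mem_filter, Finset.mem_Icc, Finset.mem_image, Finset.mem_Ioc] at hj ⊢
    exact ⟨j - i, by omega, by omega⟩
  refine (Finset.sum_le_sum_of_subset_of_nonneg hsub fun _ _ _ => hΘ _).trans (le_of_eq ?_)
  rw [Finset.sum_image fun a _ b _ h => Nat.add_left_cancel h]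
  simp

/-- One cutoff width ε serves all pairs up to n. It is kept free here, together with the gap G, so
that both can be optimised later. -/
theorem posCovSum_hit_le_of_annulus {f : X → X} {ν : Measure X} [IsProbabilityMeasure ν]
    (hf : MeasurePreserving f ν ν) {Θ : ℕ → ℝ} (hΘ : DecayOfCorrelations f ν Θ) (c : X)
    (r : ℕ → ℝ) {ε η : ℝ} (hε : 0 < ε) (hε1 : ε ≤ 1) (hη : 0 ≤ η) {n₀ : ℕ}
    (hann : ∀ k, n₀ ≤ k →
      ν.real (Metric.ball c (r k + ε)) ≤ ν.real (Metric.ball c (r k)) + η) (n G : ℕ) :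
    posCovSum ν (hit f c r) n ≤ 2 * ((n₀ + G + 1 + 2 * n * η) * E ν c r n + (n * η) ^ 2
      + 4 / ε ^ 2 * (n * ∑ k ∈ Finset.Ioc G n, Θ k)) := by
  have hΘ0 := hΘ.nonneg
  set e : ℕ → ℝ := fun k => ν.real (Metric.ball c (r k)) with he
  have he0 : ∀ k, 0 ≤ e k := fun k => measureReal_nonneg
  -- The terms cover, in turn, early indices i < n₀ where the annulus bound is not available, pairs
  -- within the gap G, the cutoff error, and the correlation of distant pairs.
  have hpt : ∀ i j, (if i ≤ j then posCov f ν c r i j else 0) ≤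
      (if i ∈ Finset.range n₀ then 1 else 0) * e j
      + e i * (if j ∈ Finset.Icc i (i + G) then 1 else 0)
      + (η * e i + η * e j + η ^ 2) + 4 / ε ^ 2 * (if i + G < j then Θ (j - i) else 0) := by
    intro i j
    have hA : 0 ≤ (if i ∈ Finset.range n₀ then (1 : ℝ) else 0) * e j :=
      mul_nonneg (by split_ifs <;> norm_num) (he0 j)
    have hB : 0 ≤ e i * (if j ∈ Finset.Icc i (i + G) then (1 : ℝ) else 0) :=
      mul_nonneg (he0 i) (by split_ifs <;> norm_num)
    have hC : 0 ≤ η * e i + η * e j + η ^ 2 := by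
      have := he0 i; have := he0 j; positivity
    have hD : 0 ≤ 4 / ε ^ 2 * (if i + G < j then Θ (j - i) else 0) :=
      mul_nonneg (by positivity) (by split_ifs <;> simp [hΘ0])
    by_cases hij : i ≤ j
    swap
    · rw [if_neg hij]; linarith
    rw [if_pos hij]
    by_cases hi : i < n₀
    · rw [if_pos (Finset.mem_range.2 hi), one_mul]
      have := posCov_le_left hf c r j i
      rw [posCov_comm] at this
      change _ ≤ e j at this
      linarith
    by_cases hjG : j ≤ i + G
    · rw [if_pos (Finset.mem_Icc.2 ⟨hij, hjG⟩), mul_one] at hB ⊢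
      have := posCov_le_left hf c r i j
      change _ ≤ e i at this
      linarith
    rw [if_pos (show i + G < j by omega)] at hD ⊢
    obtain ⟨k, rfl⟩ := Nat.exists_eq_add_of_le hij
    rw [Nat.add_sub_cancel_left] at hD ⊢
    refine max_le ?_ (by linarith)
    rw [integral_hit_mul_hit hf, integral_hit hf, integral_hit hf]
    have := integral_indicator_ball_mul_le hf hΘ c hε hε1 (hann i (by omega))
      (hann (i + k) (by omega)) k
    change _ ≤ η * (e i + e (i + k)) + η ^ 2 + _ at this
    linarith
  refine (sum_sum_symm_le (posCov_nonneg f ν c r) (posCov_comm f ν c r) _).trans ?_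
  refine mul_le_mul_of_nonneg_left ?_ zero_le_two
  have hE : E ν c r n = ∑ k ∈ Finset.Icc 1 n, e k := rfl
  have hE0 : 0 ≤ E ν c r n := hE ▸ Finset.sum_nonneg fun k _ => he0 k
  have hcount : ∀ s : Finset ℕ, (∑ j ∈ Finset.Icc 1 n, if j ∈ s then (1 : ℝ) else 0) ≤ s.card := by
    intro s
    rw [Finset.sum_ite_mem, Finset.sum_const, nsmul_eq_mul, mul_one]
    exact_mod_cast Finset.card_le_card Finset.inter_subset_right
  have hrow : ∀ i, (∑ j ∈ Finset.Icc 1 n, if i ≤ j then posCov f ν c r i j else 0) ≤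
      (if i ∈ Finset.range n₀ then 1 else 0) * E ν c r n + e i * (G + 1)
      + (η * (n * e i) + η * E ν c r n + n * η ^ 2)
      + 4 / ε ^ 2 * ∑ k ∈ Finset.Ioc G n, Θ k := by
    intro i
    refine (Finset.sum_le_sum fun j _ => hpt i j).trans ?_
    simp only [Finset.sum_add_distrib, ← Finset.mul_sum, Finset.sum_const, Nat.card_Icc,
      Nat.add_sub_cancel, nsmul_eq_mul, ← hE]
    have h1 := hcount (Finset.Icc i (i + G))
    rw [Nat.card_Icc, show i + G + 1 - i = G + 1 by omega] at h1
    push_cast at h1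
    have h2 := sum_shifted_tail_le hΘ0 n G i
    have := he0 i
    gcongr
  refine (Finset.sum_le_sum fun i _ => hrow i).trans ?_
  simp only [Finset.sum_add_distrib, ← Finset.mul_sum, ← Finset.sum_mul, Finset.sum_const,
    Nat.card_Icc, Nat.add_sub_cancel, nsmul_eq_mul, ← hE]
  have h1 := hcount (Finset.range n₀)
  rw [Finset.card_range] at h1
  have h2 := mul_le_mul_of_nonneg_right h1 hE0
  linarith

/-- The summed covariance bound for shrinking balls about a regular, null centre. -/
theorem exists_posCovSum_hit_le {f : X → X} {ν : Measure X} [IsProbabilityMeasure ν]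
    (hf : MeasurePreserving f ν ν) {Θ : ℕ → ℝ} (hΘ : DecayOfCorrelations f ν Θ) {c : X} {δ : ℝ}
    (hδ : AnnulusRegular ν c δ) (hpos : ∀ r, 0 < r → 0 < ν.real (Metric.ball c r)) {r : ℕ → ℝ}
    (hr0 : ∀ᶠ n in atTop, 0 < r n)
    (hr : Tendsto (fun n => ν.real (Metric.ball c (r n))) atTop (𝓝 0)) :
    ∃ K : ℝ, 0 ≤ K ∧ ∀ᶠ n : ℕ in atTop, ∀ G : ℕ, posCovSum ν (hit f c r) n ≤
      K * ((G + 1) * E ν c r n + 1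
        + (n : ℝ) ^ (2 / δ) * (n * ∑ k ∈ Finset.Ioc G n, Θ k)) := by
  have hsmall : ∀ η : ℝ, 0 < η → ∃ ρ : ℝ, 0 < ρ ∧ ν.real (Metric.ball c ρ) < η := fun η hη => by
    obtain ⟨n, h1, h2⟩ := (hr0.and (hr.eventually_lt_const hη)).exists
    exact ⟨r n, h1, h2⟩
  have hΘ0 := hΘ.nonneg
  obtain ⟨C, hC, R, hR, hann⟩ := hδ.exists_measureReal_ball_add_le hsmall
  have hδ0 := hδ.1
  -- Smallness of the radii is read off from the measures: a ball of radius at least R has measure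
  -- at least ν(B(c, R)) > 0.
  have hrR : ∀ᶠ n in atTop, r n < R := by
    filter_upwards [hr.eventually_lt_const (hpos R hR)] with n hn
    by_contra! hge
    exact absurd (measureReal_mono (μ := ν) (Metric.ball_subset_ball (x := c) hge)) (not_le.2 hn)
  obtain ⟨n₀, hn₀⟩ := eventually_atTop.1 hrR
  have hεt : Tendsto (fun n : ℕ => (n : ℝ) ^ (-(1 / δ))) atTop (𝓝 0) :=
    (tendsto_rpow_neg_atTop (by positivity)).comp tendsto_natCast_atTop_atTop
  refine ⟨2 * (n₀ + 1 + 2 * C + C ^ 2 + 4), by positivity, ?_⟩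
  filter_upwards [hεt.eventually_lt_const hR, hεt.eventually_lt_const one_pos,
    eventually_ge_atTop 1] with n hnR hn1 hn G
  have hn' : (0 : ℝ) < n := by exact_mod_cast hn
  -- This makes ε^δ = 1/n, so n annulus errors sum to a constant, at the price 1/ε^2 = n^{2/δ} in
  -- front of Θ.
  set ε := (n : ℝ) ^ (-(1 / δ)) with hε
  have hε0 : 0 < ε := by positivity
  have hεδ : ε ^ δ = (n : ℝ)⁻¹ := by
    rw [hε, ← Real.rpow_mul hn'.le, neg_mul, one_div_mul_cancel hδ0.ne', Real.rpow_neg_one]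
  have hε2 : 4 / ε ^ 2 = 4 * (n : ℝ) ^ (2 / δ) := by
    rw [hε, Real.rpow_neg hn'.le, inv_pow, div_inv_eq_mul, ← Real.rpow_natCast,
      ← Real.rpow_mul hn'.le]
    congr 2
    push_cast
    ring
  have h := posCovSum_hit_le_of_annulus hf hΘ c r hε0 hn1.le
    (η := C * ε ^ δ) (by positivity) (fun k hk => hann (r k) ε (hn₀ k hk) hε0 hnR) n G
  have hnη : n * (C * ε ^ δ) = C := by rw [hεδ]; field_simp
  rw [mul_assoc 2 (n : ℝ), hnη, hε2, mul_assoc 4] at h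
  refine h.trans ?_
  rw [mul_assoc 2]
  refine mul_le_mul_of_nonneg_left ?_ zero_le_two
  have hE0 : 0 ≤ E ν c r n := Finset.sum_nonneg fun k _ => measureReal_nonneg
  set T := (n : ℝ) ^ (2 / δ) * (n * ∑ k ∈ Finset.Ioc G n, Θ k)
  have hT : 0 ≤ T := mul_nonneg (by positivity)
    (mul_nonneg hn'.le (Finset.sum_nonneg fun k _ => hΘ0 k))
  have hGE : 0 ≤ (G : ℝ) * E ν c r n := by positivity
  have hn0 : (0 : ℝ) ≤ n₀ := by positivity
  have x1 : 0 ≤ (n₀ : ℝ) * (G * E ν c r n) := by positivity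
  have x2 : 0 ≤ C * (G * E ν c r n) := by positivity
  have x3 : 0 ≤ C ^ 2 * (G * E ν c r n) := by positivity
  have x4 : 0 ≤ C ^ 2 * E ν c r n := by positivity
  have x5 : 0 ≤ (n₀ : ℝ) * T := by positivity
  have x6 : 0 ≤ C * T := by positivity
  have x7 : 0 ≤ C ^ 2 * T := by positivity
  nlinarith

end Covariance

/-! ### Elementary estimates for sums. -/

section Sums

/-- Bernoulli's inequality (1 + 1/x)^ζ ≥ 1 + ζ/x, multiplied by x · x^{-ζ} (x+1)^{-ζ}. The
right-hand side telescopes, replacing an integral comparison. -/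
theorem rpow_neg_step {ζ x : ℝ} (hζ : 1 < ζ) (hx : 0 < x) :
    (ζ - 1) * (x + 1) ^ (-ζ) ≤ x ^ (1 - ζ) - (x + 1) ^ (1 - ζ) := by
  have hx1 : 0 < x + 1 := by linarith
  have hB := one_add_mul_self_le_rpow_one_add (s := 1 / x) (by linarith [one_div_pos.2 hx]) hζ.le
  rw [show 1 + 1 / x = (x + 1) / x by field_simp, Real.div_rpow hx1.le hx.le,
    le_div_iff₀ (by positivity)] at hB
  have e1 : (x + 1) ^ (1 - ζ) = (x + 1) * (x + 1) ^ (-ζ) := by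
    rw [sub_eq_add_neg, Real.rpow_add hx1, Real.rpow_one]
  have e2 : x ^ (1 - ζ) = x * x ^ (-ζ) := by
    rw [sub_eq_add_neg, Real.rpow_add hx, Real.rpow_one]
  have h1 : (x + 1) ^ ζ * (x + 1) ^ (-ζ) = 1 := by
    rw [← Real.rpow_add hx1, add_neg_cancel, Real.rpow_zero]
  have h2 : x ^ ζ * x ^ (-ζ) = 1 := by rw [← Real.rpow_add hx, add_neg_cancel, Real.rpow_zero]
  have h3 : 0 < x ^ (-ζ) := by positivity
  have h4 : 0 < (x + 1) ^ (-ζ) := by positivity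
  have h5 := mul_le_mul_of_nonneg_right hB (mul_nonneg (mul_nonneg hx.le h3.le) h4.le)
  have h6 : (1 + ζ * (1 / x)) * x ^ ζ * (x * x ^ (-ζ) * (x + 1) ^ (-ζ))
      = (x + ζ) * (x + 1) ^ (-ζ) * (x ^ ζ * x ^ (-ζ)) := by field_simp
  have h7 : (x + 1) ^ ζ * (x * x ^ (-ζ) * (x + 1) ^ (-ζ))
      = x * x ^ (-ζ) * ((x + 1) ^ ζ * (x + 1) ^ (-ζ)) := by ring
  rw [h6, h7, h1, h2] at h5
  rw [e1, e2]
  linarith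

theorem sum_Ioc_rpow_neg_le {ζ : ℝ} (hζ : 1 < ζ) {G : ℕ} (hG : 1 ≤ G) (n : ℕ) :
    ∑ k ∈ Finset.Ioc G n, (k : ℝ) ^ (-ζ) ≤ (G : ℝ) ^ (1 - ζ) / (ζ - 1) := by
  have hζ' : 0 < ζ - 1 := by linarith
  rcases le_total n G with h | h
  · rw [Finset.Ioc_eq_empty (by omega), Finset.sum_empty]
    positivity
  · have key : ∑ k ∈ Finset.Ioc G n, (k : ℝ) ^ (-ζ)
        ≤ ((G : ℝ) ^ (1 - ζ) - (n : ℝ) ^ (1 - ζ)) / (ζ - 1) := by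
      induction n, h using Nat.le_induction with
      | base => simp
      | succ n hn ih =>
        rw [Finset.sum_Ioc_succ_top hn]
        have hs := rpow_neg_step hζ (x := n) (by exact_mod_cast (by omega : 0 < n))
        rw [le_div_iff₀ hζ'] at ih ⊢
        push_cast
        linarith
    refine key.trans ?_
    gcongr
    linarith [Real.rpow_nonneg (Nat.cast_nonneg (α := ℝ) n) (1 - ζ)]

theorem log_sub_log_le_sum_Ioc_inv {m n : ℕ} (h : m ≤ n) :
    Real.log (n + 1) - Real.log (m + 1) ≤ ∑ k ∈ Finset.Ioc m n, (1 : ℝ) / k := by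
  induction n, h using Nat.le_induction with
  | base => simp
  | succ n hn ih =>
    rw [Finset.sum_Ioc_succ_top hn]
    have h1 : Real.log ((n + 1 + 1 : ℝ) / (n + 1)) ≤ (n + 1 + 1 : ℝ) / (n + 1) - 1 :=
      Real.log_le_sub_one_of_pos (by positivity)
    rw [Real.log_div (by positivity) (by positivity)] at h1
    have h2 : (n + 1 + 1 : ℝ) / (n + 1) - 1 = 1 / (n + 1) := by field_simp; ring
    push_cast
    linarith

/-- At least n/2 of the terms obey the formula, and each of these is at least n^{-β}. -/
theorem half_rpow_le_sum {e : ℕ → ℝ} (he : ∀ k, 0 ≤ e k) {β : ℝ} (hβ : 0 < β)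
    (h : ∀ᶠ n : ℕ in atTop, e n = (n : ℝ) ^ (-β)) :
    ∀ᶠ n : ℕ in atTop, (n : ℝ) ^ (1 - β) ≤ 2 * ∑ k ∈ Finset.Icc 1 n, e k := by
  obtain ⟨n₀, hn₀⟩ := eventually_atTop.1 h
  filter_upwards [eventually_ge_atTop (2 * n₀ + 1)] with n hn
  have hn0 : (0 : ℝ) < n := by exact_mod_cast (by omega : 0 < n)
  have h1 : ((n - n₀ : ℕ) : ℝ) * (n : ℝ) ^ (-β) ≤ ∑ k ∈ Finset.Ioc n₀ n, e k := by
    have := Finset.card_nsmul_le_sum (Finset.Ioc n₀ n) e ((n : ℝ) ^ (-β)) fun k hk => by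
      rw [Finset.mem_Ioc] at hk
      rw [hn₀ k hk.1.le]
      exact Real.rpow_le_rpow_of_nonpos (by exact_mod_cast (by omega : 0 < k))
        (by exact_mod_cast hk.2) (by linarith)
    simpa using this
  have h2 : ∑ k ∈ Finset.Ioc n₀ n, e k ≤ ∑ k ∈ Finset.Icc 1 n, e k :=
    Finset.sum_le_sum_of_subset_of_nonneg (fun k hk => by simp at hk ⊢; omega) fun k _ _ => he k
  have h3 : (n : ℝ) / 2 ≤ ((n - n₀ : ℕ) : ℝ) := by
    rw [Nat.cast_sub (by omega)]
    have : (2 : ℝ) * n₀ + 1 ≤ n := by exact_mod_cast hn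
    linarith
  have h4 : (n : ℝ) ^ (1 - β) = n * (n : ℝ) ^ (-β) := by
    rw [sub_eq_add_neg, Real.rpow_add hn0, Real.rpow_one]
  have h5 : (n : ℝ) / 2 * (n : ℝ) ^ (-β) ≤ ((n - n₀ : ℕ) : ℝ) * (n : ℝ) ^ (-β) := by gcongr
  rw [h4]
  linarith

/-- On √n < k ≤ n, log k lies between half of log n and log n, so log^β is constant up to a factor,
and the harmonic sum over this range is at least a quarter of log n. -/
theorem exists_log_rpow_le_sum {e : ℕ → ℝ} (he : ∀ k, 0 ≤ e k) {β : ℝ}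
    (h : ∀ᶠ n : ℕ in atTop, e n = Real.log n ^ β / n) :
    ∃ C : ℝ, 0 < C ∧ ∀ᶠ n : ℕ in atTop,
      Real.log n ^ (1 + β) ≤ C * ∑ k ∈ Finset.Icc 1 n, e k := by
  obtain ⟨n₀, hn₀⟩ := eventually_atTop.1 h
  -- The minimum handles both signs of β at once.
  set a : ℝ := min 1 ((1 / 2) ^ β) with ha
  have ha0 : 0 < a := by positivity
  refine ⟨4 / a, by positivity, ?_⟩
  have hlog : Tendsto (fun n : ℕ => Real.log n) atTop atTop :=
    Real.tendsto_log_atTop.comp tendsto_natCast_atTop_atTop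
  filter_upwards [eventually_ge_atTop ((n₀ + 1) ^ 2), eventually_ge_atTop 2,
    hlog.eventually_ge_atTop (4 * Real.log 2)] with n hn hn2 hnl
  have hn0 : (0 : ℝ) < n := by exact_mod_cast (by omega : 0 < n)
  have hl2 : 0 < Real.log 2 := Real.log_pos (by norm_num)
  have hl0 : 0 < Real.log n := by linarith
  set m := Nat.sqrt n with hm
  have hmn₀ : n₀ ≤ m := by
    have : n₀ + 1 ≤ m := Nat.le_sqrt'.2 hn
    omega
  have hm1 : m * m ≤ n := Nat.sqrt_le n
  have hm2 : n < (m + 1) * (m + 1) := Nat.lt_succ_sqrt n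
  have hmn : m ≤ n := Nat.sqrt_le_self n
  have hmpos : 1 ≤ m := Nat.sqrt_pos.2 (by omega)
  have hpt : ∀ k ∈ Finset.Ioc m n, a * Real.log n ^ β * (1 / k) ≤ e k := by
    intro k hk
    rw [Finset.mem_Ioc] at hk
    have hk0 : (0 : ℝ) < k := by exact_mod_cast (by omega : 0 < k)
    have hkn : Real.log k ≤ Real.log n := Real.log_le_log hk0 (by exact_mod_cast hk.2)
    have hkn2 : 1 / 2 * Real.log n ≤ Real.log k := by
      have h1 : n ≤ k ^ 2 := by nlinarith
      have h2 : Real.log n ≤ Real.log ((k : ℝ) ^ 2) :=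
        Real.log_le_log hn0 (by exact_mod_cast h1)
      rw [Real.log_pow] at h2
      push_cast at h2
      linarith
    rw [hn₀ k (by omega), div_eq_mul_one_div (Real.log k ^ β)]
    refine mul_le_mul_of_nonneg_right ?_ (by positivity)
    rcases le_total 0 β with hβ | hβ
    · calc a * Real.log n ^ β ≤ (1 / 2) ^ β * Real.log n ^ β := by gcongr; exact min_le_right _ _
        _ = (1 / 2 * Real.log n) ^ β := (Real.mul_rpow (by norm_num) hl0.le).symm
        _ ≤ _ := Real.rpow_le_rpow (by positivity) hkn2 hβ
    · calc a * Real.log n ^ β ≤ 1 * Real.log n ^ β := by gcongr; exact min_le_left _ _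
        _ = Real.log n ^ β := one_mul _
        _ ≤ _ := Real.rpow_le_rpow_of_nonpos (by linarith) hkn hβ
  have h1 := Finset.sum_le_sum hpt
  rw [← Finset.mul_sum] at h1
  have h2 : ∑ k ∈ Finset.Ioc m n, e k ≤ ∑ k ∈ Finset.Icc 1 n, e k :=
    Finset.sum_le_sum_of_subset_of_nonneg (fun k hk => by simp at hk ⊢; omega) fun k _ _ => he k
  have h3 : Real.log n / 4 ≤ ∑ k ∈ Finset.Ioc m n, (1 : ℝ) / k := by
    refine le_trans ?_ (log_sub_log_le_sum_Ioc_inv hmn)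
    have l1 : Real.log n ≤ Real.log (n + 1) := Real.log_le_log hn0 (by linarith)
    have hm0 : (0 : ℝ) < m := by exact_mod_cast hmpos
    have l2 : Real.log ((m : ℝ) + 1) ≤ Real.log (2 * m) :=
      Real.log_le_log (by positivity) (by
        have : (1 : ℝ) ≤ m := by exact_mod_cast hmpos
        linarith)
    rw [Real.log_mul (by norm_num) hm0.ne'] at l2
    have l3 : Real.log ((m : ℝ) * m) ≤ Real.log n :=
      Real.log_le_log (by positivity) (by exact_mod_cast hm1)
    rw [Real.log_mul hm0.ne' hm0.ne'] at l3
    linarith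
  have h4 : a * Real.log n ^ β * (Real.log n / 4)
      ≤ a * Real.log n ^ β * ∑ k ∈ Finset.Ioc m n, (1 : ℝ) / k := by gcongr
  have h5 : Real.log n ^ (1 + β) = Real.log n * Real.log n ^ β := by
    rw [Real.rpow_add hl0, Real.rpow_one]
  have h6 : Real.log n ^ (1 + β) = 4 / a * (a * Real.log n ^ β * (Real.log n / 4)) := by
    rw [h5]; field_simp
  rw [h6]
  gcongr
  linarith

theorem summable_log_rpow_div {β : ℝ} (hβ : β < -1) :
    Summable fun n : ℕ => Real.log n ^ β / n := by
  -- Cauchy condensation needs monotonicity from index 1 on. It fails without the shift, since log 1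
  -- = 0 and `0 ^ β = 0` for this β.
  rw [← summable_nat_add_iff 1]
  have hl2 : 0 < Real.log 2 := Real.log_pos (by norm_num)
  refine (summable_condensed_iff_of_nonneg (fun n => ?_) fun m n hm hmn => ?_).1 ?_
  · exact div_nonneg (Real.rpow_nonneg (Real.log_natCast_nonneg _) _) (Nat.cast_nonneg _)
  · have hm' : (0 : ℝ) < m := by exact_mod_cast hm
    have hmn' : (m : ℝ) ≤ n := by exact_mod_cast hmn
    push_cast
    have h1 : 0 < Real.log (m + 1) := Real.log_pos (by linarith)
    have h2 : Real.log (m + 1) ≤ Real.log (n + 1) := Real.log_le_log (by linarith) (by linarith)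
    have h3 := Real.rpow_le_rpow_of_nonpos h1 h2 (by linarith : β ≤ 0)
    gcongr
  · have hs : Summable fun k : ℕ => Real.log 2 ^ β * (k : ℝ) ^ β :=
      (Real.summable_nat_rpow.2 hβ).mul_left _
    refine Summable.of_norm_bounded_eventually_nat hs ?_
    filter_upwards [eventually_ge_atTop 1] with k hk
    have hk' : (0 : ℝ) < k := by exact_mod_cast hk
    have hp : (0 : ℝ) < 2 ^ k := by positivity
    push_cast
    have h1 : Real.log 2 * k ≤ Real.log (2 ^ k + 1) := by
      rw [mul_comm, ← Real.log_pow]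
      exact Real.log_le_log hp (by linarith)
    have h2 := Real.rpow_le_rpow_of_nonpos (by positivity) h1 (by linarith : β ≤ 0)
    rw [Real.mul_rpow hl2.le hk'.le] at h2
    have h0 : 0 ≤ Real.log (2 ^ k + 1) ^ β :=
      Real.rpow_nonneg (Real.log_nonneg (by linarith)) _
    rw [Real.norm_of_nonneg (by positivity)]
    refine le_trans ?_ h2
    rw [mul_div_assoc', div_le_iff₀ (by positivity), mul_comm]
    exact mul_le_mul_of_nonneg_left (by linarith) h0

end Sums

/-! ### Choice of the gap and the Borel–Cantelli estimates. -/

section BorelCantelli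

variable {X : Type*} [MetricSpace X] [MeasurableSpace X]

theorem radius_pos_of_measureReal_ball_pos {ν : Measure X} {c : X} {r : ℝ}
    (h : 0 < ν.real (Metric.ball c r)) : 0 < r := by
  by_contra! hr
  rw [Metric.ball_eq_empty.2 hr, measureReal_empty] at h
  exact lt_irrefl _ h

variable [OpensMeasurableSpace X]

/-- The quantitative dynamical Borel–Cantelli lemma, reduced to the choice of a gap `G`. -/
theorem ae_isBigO_of_gap {f : X → X} {ν : Measure X} [IsProbabilityMeasure ν]
    (hf : MeasurePreserving f ν ν) {Θ : ℕ → ℝ} (hΘ : DecayOfCorrelations f ν Θ) {c : X} {δ : ℝ}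
    (hδ : AnnulusRegular ν c δ) (hpos : ∀ r, 0 < r → 0 < ν.real (Metric.ball c r)) {r : ℕ → ℝ}
    (hr0 : ∀ᶠ n in atTop, 0 < r n)
    (hr : Tendsto (fun n => ν.real (Metric.ball c (r n))) atTop (𝓝 0))
    (hE : Tendsto (E ν c r) atTop atTop) {σ C : ℝ} (hσ : 0 ≤ σ) (G : ℕ → ℕ)
    (hG : ∀ᶠ n in atTop, (G n : ℝ) + 1 ≤ C * E ν c r n ^ σ)
    (hT : ∀ᶠ n : ℕ in atTop, (n : ℝ) ^ (2 / δ) * (n * ∑ k ∈ Finset.Ioc (G n) n, Θ k)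
      ≤ C * E ν c r n ^ (1 + σ)) :
    ∀ᵐ x ∂ν, ∀ β : ℝ, (1 + σ) / 2 < β →
      (fun n => S f c r n x - E ν c r n) =O[atTop] fun n => E ν c r n ^ β := by
  have hEe : ∀ n, ∑ k ∈ Finset.Icc 1 n, ∫ x, hit f c r k x ∂ν = E ν c r n := fun n =>
    Finset.sum_congr rfl fun k _ => integral_hit hf c r k
  obtain ⟨K, hK, hA⟩ := exists_posCovSum_hit_le hf hΘ hδ hpos hr0 hr
  have hA' : ∀ᶠ n in atTop, posCovSum ν (hit f c r) n ≤ K * (C + 1 + C)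
      * (∑ k ∈ Finset.Icc 1 n, ∫ x, hit f c r k x ∂ν) ^ (2 * ((1 + σ) / 2)) := by
    filter_upwards [hA, hG, hT, hE.eventually_ge_atTop 1] with n h1 h2 h3 h4
    rw [hEe, mul_div_cancel₀ _ two_ne_zero, mul_assoc]
    refine (h1 (G n)).trans (mul_le_mul_of_nonneg_left ?_ hK)
    have h5 : E ν c r n ^ (1 + σ) = E ν c r n * E ν c r n ^ σ := by
      rw [Real.rpow_add (by linarith), Real.rpow_one]
    have h6 : ((G n : ℝ) + 1) * E ν c r n ≤ C * E ν c r n ^ σ * E ν c r n := by gcongr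
    have h7 : 1 ≤ E ν c r n ^ (1 + σ) := Real.one_le_rpow h4 (by linarith)
    have h8 : C * E ν c r n ^ σ * E ν c r n = C * E ν c r n ^ (1 + σ) := by rw [h5]; ring
    linarith
  have key := ae_forall_isBigO_rpow_of_posCovSum_le (μ := ν) (g := hit f c r)
    (measurable_hit hf.measurable c r) (hit_nonneg f c r) (hit_le_one f c r)
    (by simpa only [hEe] using hE) (by linarith) hA'
  simp only [hEe] at key
  exact key

theorem ae_isBigO_of_polynomial_decay {f : X → X} {ν : Measure X} [IsProbabilityMeasure ν]
    (hf : MeasurePreserving f ν ν) {Θ : ℕ → ℝ} (hΘ : DecayOfCorrelations f ν Θ) {c : X} {δ : ℝ}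
    (hδ : AnnulusRegular ν c δ) (hpos : ∀ r, 0 < r → 0 < ν.real (Metric.ball c r)) {r : ℕ → ℝ}
    {ζ β : ℝ} (hζ : 0 < ζ) (hΘζ : Θ =O[atTop] fun n : ℕ => (n : ℝ) ^ (-ζ)) (hβ0 : 0 < β)
    (hβ1 : β < 1) (hB : ∀ᶠ n : ℕ in atTop, ν.real (Metric.ball c (r n)) = (n : ℝ) ^ (-β)) :
    ∀ᵐ x ∂ν, ∀ β' : ℝ, (2 * δ⁻¹ + β + ζ * (1 - β)) / (2 * ζ * (1 - β)) < β' →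
      (fun n => S f c r n x - E ν c r n) =O[atTop] fun n => E ν c r n ^ β' := by
  have hδ0 := hδ.1
  have hβ1' : 0 < 1 - β := by linarith
  have hr : Tendsto (fun n => ν.real (Metric.ball c (r n))) atTop (𝓝 0) :=
    ((tendsto_rpow_neg_atTop hβ0).comp tendsto_natCast_atTop_atTop).congr'
      (hB.mono fun n h => h.symm)
  have hr0 : ∀ᶠ n in atTop, 0 < r n := by
    filter_upwards [hB, eventually_ge_atTop 1] with n h hn
    have : (0 : ℝ) < n := by exact_mod_cast hn
    exact radius_pos_of_measureReal_ball_pos (by rw [h]; positivity)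
  have hδ1 : δ ≤ 1 := hδ.exponent_le_one hpos fun η hη => by
    obtain ⟨n, h1, h2⟩ := (hr0.and (hr.eventually_lt_const hη)).exists
    exact ⟨r n, h1, h2⟩
  have hlow : ∀ᶠ n : ℕ in atTop, (n : ℝ) ^ (1 - β) ≤ 2 * E ν c r n :=
    half_rpow_le_sum (e := fun k => ν.real (Metric.ball c (r k))) (fun k => measureReal_nonneg)
      hβ0 hB
  have hE : Tendsto (E ν c r) atTop atTop := by
    have h1 : Tendsto (fun n : ℕ => (n : ℝ) ^ (1 - β)) atTop atTop :=
      (tendsto_rpow_atTop hβ1').comp tendsto_natCast_atTop_atTop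
    have h2 := tendsto_atTop_mono' atTop hlow h1
    exact (tendsto_const_mul_atTop_of_pos two_pos).1 h2
  -- The gap n^τ balances the two contributions: with τζ = 2/δ + β, the tail term n^{2/δ + 1 +
  -- τ(1-ζ)} equals n^{1-β+τ}, the order of the close-pair term. Then σ = τ/(1-β) re-expresses n^τ
  -- as a power of n^{1-β}, which is at most 2 E_n.
  set τ : ℝ := (2 / δ + β) / ζ with hτ
  have hτ0 : 0 < τ := by positivity
  set σ : ℝ := τ / (1 - β) with hσ
  have hσ0 : 0 < σ := by positivity
  obtain ⟨K, hK0, hK⟩ := hΘζ.exists_pos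
  obtain ⟨N, hN⟩ := eventually_atTop.1 hK.bound
  -- The absolute value keeps K' nonnegative before ζ > 1 is known; the tail estimate uses K' only
  -- after that.
  set K' : ℝ := K / |ζ - 1| with hK'
  have hK'0 : 0 ≤ K' := by positivity
  have hthr : (2 * δ⁻¹ + β + ζ * (1 - β)) / (2 * ζ * (1 - β)) = (1 + σ) / 2 := by
    rw [hσ, hτ]
    field_simp
    ring
  rw [hthr]
  have hτt : Tendsto (fun n : ℕ => (n : ℝ) ^ τ) atTop atTop :=
    (tendsto_rpow_atTop hτ0).comp tendsto_natCast_atTop_atTop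
  refine ae_isBigO_of_gap hf hΘ hδ hpos hr0 hr hE (σ := σ)
    (C := 3 * 2 ^ σ + K' * 2 ^ (1 + σ)) hσ0.le (fun n => ⌈(n : ℝ) ^ τ⌉₊) ?_ ?_
  · filter_upwards [hlow, eventually_ge_atTop 1, hE.eventually_ge_atTop 1] with n hl hn hE1
    have hn' : (1 : ℝ) ≤ n := by exact_mod_cast hn
    have h1 : (n : ℝ) ^ τ ≤ 2 ^ σ * E ν c r n ^ σ := by
      rw [← Real.mul_rpow (by norm_num) (by linarith)]
      calc (n : ℝ) ^ τ = ((n : ℝ) ^ (1 - β)) ^ σ := by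
            rw [← Real.rpow_mul (by positivity), hσ, mul_div_cancel₀ _ hβ1'.ne']
        _ ≤ _ := by gcongr
    have h2 : (⌈(n : ℝ) ^ τ⌉₊ : ℝ) < (n : ℝ) ^ τ + 1 := Nat.ceil_lt_add_one (by positivity)
    have h3 : 1 ≤ (n : ℝ) ^ τ := Real.one_le_rpow hn' hτ0.le
    have h4 : 0 ≤ K' * 2 ^ (1 + σ) * E ν c r n ^ σ := by positivity
    linarith
  · filter_upwards [hlow, eventually_ge_atTop 1, hE.eventually_ge_atTop 1,
      hτt.eventually_ge_atTop (max N 1)] with n hl hn hE1 hnτ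
    have hn' : (1 : ℝ) ≤ n := by exact_mod_cast hn
    have hn0 : (0 : ℝ) < n := by linarith
    set G := ⌈(n : ℝ) ^ τ⌉₊ with hG
    have hGτ : (n : ℝ) ^ τ ≤ G := Nat.le_ceil _
    -- For τ ≥ 1 the gap exceeds n and no distant pairs remain.
    rcases le_or_gt 1 τ with hτ1 | hτ1
    · have : n ≤ G := by
        have h1 : (n : ℝ) ≤ (n : ℝ) ^ τ := by
          simpa using Real.rpow_le_rpow_of_exponent_le hn' hτ1
        exact_mod_cast h1.trans hGτ
      rw [Finset.Ioc_eq_empty (by omega), Finset.sum_empty, mul_zero, mul_zero]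
      positivity
    -- From τ < 1 one gets ζ > 2/δ + β, and δ ≤ 1 makes this exceed 2, so the tail of k^{-ζ}
    -- converges.
    have hζ1 : 1 < ζ := by
      rw [hτ, div_lt_one hζ] at hτ1
      have : 2 ≤ 2 / δ := by rw [le_div_iff₀ hδ0]; linarith
      linarith
    have hGN : (max N 1 : ℕ) ≤ G := by
      have : ((max N 1 : ℕ) : ℝ) ≤ G := by
        push_cast
        exact hnτ.trans hGτ
      exact_mod_cast this
    have h1 : ∑ k ∈ Finset.Ioc G n, Θ k ≤ K * ∑ k ∈ Finset.Ioc G n, (k : ℝ) ^ (-ζ) := by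
      rw [Finset.mul_sum]
      refine Finset.sum_le_sum fun k hk => ?_
      rw [Finset.mem_Ioc] at hk
      have := (le_abs_self _).trans (hN k (by omega))
      rwa [Real.norm_of_nonneg (by positivity)] at this
    have h2 := sum_Ioc_rpow_neg_le hζ1 (by omega : 1 ≤ G) n
    have h3 : (G : ℝ) ^ (1 - ζ) ≤ (n : ℝ) ^ (τ * (1 - ζ)) := by
      rw [Real.rpow_mul hn0.le]
      exact Real.rpow_le_rpow_of_nonpos (by positivity) hGτ (by linarith)
    have hζ' : 0 < ζ - 1 := by linarith
    have h4 : ∑ k ∈ Finset.Ioc G n, Θ k ≤ K' * (n : ℝ) ^ (τ * (1 - ζ)) := by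
      refine h1.trans ?_
      rw [hK', abs_of_pos hζ', div_mul_eq_mul_div, mul_div_assoc]
      refine mul_le_mul_of_nonneg_left (h2.trans ?_) hK0.le
      gcongr
    have hexp : (n : ℝ) ^ (2 / δ) * (n * (n : ℝ) ^ (τ * (1 - ζ)))
        = ((n : ℝ) ^ (1 - β)) ^ (1 + σ) := by
      have e0 : n * (n : ℝ) ^ (τ * (1 - ζ)) = (n : ℝ) ^ (1 + τ * (1 - ζ)) := by
        rw [Real.rpow_add hn0, Real.rpow_one]
      have e1 : τ * ζ = 2 / δ + β := by rw [hτ]; field_simp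
      have e2 : (1 - β) * σ = τ := by rw [hσ]; field_simp
      rw [e0, ← Real.rpow_mul hn0.le, ← Real.rpow_add hn0]
      congr 1
      linear_combination -e1 - e2
    calc (n : ℝ) ^ (2 / δ) * (n * ∑ k ∈ Finset.Ioc G n, Θ k)
        ≤ (n : ℝ) ^ (2 / δ) * (n * (K' * (n : ℝ) ^ (τ * (1 - ζ)))) := by gcongr
      _ = K' * ((n : ℝ) ^ (2 / δ) * (n * (n : ℝ) ^ (τ * (1 - ζ)))) := by ring
      _ = K' * ((n : ℝ) ^ (1 - β)) ^ (1 + σ) := by rw [hexp]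
      _ ≤ K' * (2 * E ν c r n) ^ (1 + σ) := by gcongr
      _ = K' * 2 ^ (1 + σ) * E ν c r n ^ (1 + σ) := by
          rw [Real.mul_rpow (by norm_num) (by linarith), mul_assoc]
      _ ≤ (3 * 2 ^ σ + K' * 2 ^ (1 + σ)) * E ν c r n ^ (1 + σ) := by
          gcongr
          linarith [Real.rpow_pos_of_pos two_pos σ]

theorem tendsto_log_rpow_div (β : ℝ) :
    Tendsto (fun n : ℕ => Real.log n ^ β / n) atTop (𝓝 0) := by
  have h := (isLittleO_log_rpow_rpow_atTop β one_pos).tendsto_div_nhds_zero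
  simp only [Real.rpow_one] at h
  exact h.comp tendsto_natCast_atTop_atTop

theorem ae_isBigO_of_exponential_decay {f : X → X} {ν : Measure X} [IsProbabilityMeasure ν]
    (hf : MeasurePreserving f ν ν) {Θ : ℕ → ℝ} (hΘ : DecayOfCorrelations f ν Θ) {c : X} {δ : ℝ}
    (hδ : AnnulusRegular ν c δ) (hpos : ∀ r, 0 < r → 0 < ν.real (Metric.ball c r)) {r : ℕ → ℝ}
    {θ β : ℝ} (hθ0 : 0 < θ) (hθ1 : θ < 1) (hΘθ : Θ =O[atTop] fun n : ℕ => θ ^ n)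
    (hβ : -1 < β)
    (hB : ∀ᶠ n : ℕ in atTop, ν.real (Metric.ball c (r n)) = Real.log n ^ β / n) :
    ∀ᵐ x ∂ν, ∀ β' : ℝ, (2 + β) / (2 * (1 + β)) < β' →
      (fun n => S f c r n x - E ν c r n) =O[atTop] fun n => E ν c r n ^ β' := by
  have hδ0 := hδ.1
  have hβ' : 0 < 1 + β := by linarith
  have hlogt : Tendsto (fun n : ℕ => Real.log n) atTop atTop :=
    Real.tendsto_log_atTop.comp tendsto_natCast_atTop_atTop
  have hr : Tendsto (fun n => ν.real (Metric.ball c (r n))) atTop (𝓝 0) :=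
    (tendsto_log_rpow_div β).congr' (hB.mono fun n h => h.symm)
  have hr0 : ∀ᶠ n in atTop, 0 < r n := by
    filter_upwards [hB, eventually_ge_atTop 2] with n h hn
    have hn' : (2 : ℝ) ≤ n := by exact_mod_cast hn
    have : 0 < Real.log n := Real.log_pos (by linarith)
    exact radius_pos_of_measureReal_ball_pos (by rw [h]; positivity)
  obtain ⟨A, hA0, hlow⟩ := exists_log_rpow_le_sum
    (e := fun k => ν.real (Metric.ball c (r k))) (fun k => measureReal_nonneg) hB
  change ∀ᶠ n : ℕ in atTop, Real.log n ^ (1 + β) ≤ A * E ν c r n at hlow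
  have hE : Tendsto (E ν c r) atTop atTop :=
    (tendsto_const_mul_atTop_of_pos hA0).1
      (tendsto_atTop_mono' atTop hlow ((tendsto_rpow_atTop hβ').comp hlogt))
  -- E_n dominates (log n)^{1+β}, so a gap of order log n is of order at most E_n^σ.
  set σ : ℝ := 1 / (1 + β) with hσ
  have hσ0 : 0 < σ := by positivity
  have hthr : (2 + β) / (2 * (1 + β)) = (1 + σ) / 2 := by
    rw [hσ]
    field_simp
    ring
  rw [hthr]
  obtain ⟨K, hK0, hK⟩ := hΘθ.exists_pos
  obtain ⟨N, hN⟩ := eventually_atTop.1 hK.bound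
  have hlθ : Real.log θ < 0 := Real.log_neg hθ0 hθ1
  -- Beyond a gap κ log n one has θ^k ≤ n^{-(2/δ+2)}, which cancels n^{2/δ} and the n^2 pairs.
  set κ : ℝ := (2 / δ + 2) / (-Real.log θ) with hκ
  have hκ0 : 0 < κ := div_pos (by positivity) (by linarith)
  have hκθ : κ * Real.log θ = -(2 / δ + 2) := by
    have := hlθ.ne
    rw [hκ, div_neg, neg_mul, div_mul_cancel₀ _ this]
  refine ae_isBigO_of_gap hf hΘ hδ hpos hr0 hr hE (σ := σ)
    (C := (κ + 2) * A ^ σ + K) hσ0.le (fun n => ⌈κ * Real.log n⌉₊) ?_ ?_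
  · filter_upwards [hlow, hlogt.eventually_ge_atTop 1, hE.eventually_ge_atTop 1] with n hl hn hE1
    have h1 : Real.log n ≤ A ^ σ * E ν c r n ^ σ := by
      rw [← Real.mul_rpow hA0.le (by linarith)]
      calc Real.log n = (Real.log n ^ (1 + β)) ^ σ := by
            rw [← Real.rpow_mul (by linarith), hσ, mul_one_div_cancel hβ'.ne', Real.rpow_one]
        _ ≤ _ := by gcongr
    have h2 : (⌈κ * Real.log n⌉₊ : ℝ) < κ * Real.log n + 1 :=
      Nat.ceil_lt_add_one (by positivity)
    have h4 : 0 ≤ K * E ν c r n ^ σ := by positivity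
    have h5 : (κ + 2) * Real.log n ≤ (κ + 2) * (A ^ σ * E ν c r n ^ σ) := by gcongr
    linarith
  · filter_upwards [hlogt.eventually_ge_atTop (N / κ), eventually_ge_atTop 1,
      hE.eventually_ge_atTop 1] with n hnN hn hE1
    have hn' : (1 : ℝ) ≤ n := by exact_mod_cast hn
    have hn0 : (0 : ℝ) < n := by linarith
    set G := ⌈κ * Real.log n⌉₊ with hG
    have hGκ : κ * Real.log n ≤ G := Nat.le_ceil _
    have hGN : N ≤ G := by
      rw [div_le_iff₀ hκ0, mul_comm] at hnN
      exact_mod_cast hnN.trans hGκ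
    have hpt : ∀ k ∈ Finset.Ioc G n, Θ k ≤ K * (n : ℝ) ^ (-(2 / δ + 2)) := by
      intro k hk
      rw [Finset.mem_Ioc] at hk
      have h1 := (le_abs_self _).trans (hN k (by omega))
      rw [Real.norm_of_nonneg (by positivity)] at h1
      refine h1.trans (mul_le_mul_of_nonneg_left ?_ hK0.le)
      rw [← Real.rpow_natCast, Real.rpow_def_of_pos hθ0, Real.rpow_def_of_pos hn0, ← hκθ]
      refine Real.exp_le_exp.2 ?_
      have h2 : κ * Real.log n ≤ k := hGκ.trans (by exact_mod_cast hk.1.le)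
      nlinarith
    have h1 : ∑ k ∈ Finset.Ioc G n, Θ k ≤ n * (K * (n : ℝ) ^ (-(2 / δ + 2))) := by
      refine (Finset.sum_le_card_nsmul _ _ _ hpt).trans ?_
      rw [nsmul_eq_mul, Nat.card_Ioc]
      gcongr
      omega
    have hexp : (n : ℝ) ^ (2 / δ) * (n * (n * (n : ℝ) ^ (-(2 / δ + 2)))) = 1 := by
      have e : (n : ℝ) ^ (2 / δ) * (n * (n * (n : ℝ) ^ (-(2 / δ + 2))))
          = (n : ℝ) ^ (2 / δ) * (n : ℝ) ^ (2 : ℝ) * (n : ℝ) ^ (-(2 / δ + 2)) := by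
        rw [Real.rpow_two]; ring
      rw [e, ← Real.rpow_add hn0, ← Real.rpow_add hn0, add_neg_cancel, Real.rpow_zero]
    calc (n : ℝ) ^ (2 / δ) * (n * ∑ k ∈ Finset.Ioc G n, Θ k)
        ≤ (n : ℝ) ^ (2 / δ) * (n * (n * (K * (n : ℝ) ^ (-(2 / δ + 2))))) := by gcongr
      _ = K * ((n : ℝ) ^ (2 / δ) * (n * (n * (n : ℝ) ^ (-(2 / δ + 2))))) := by ring
      _ = K * 1 := by rw [hexp]
      _ ≤ ((κ + 2) * A ^ σ + K) * E ν c r n ^ (1 + σ) := by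
          have : 1 ≤ E ν c r n ^ (1 + σ) := Real.one_le_rpow hE1 (by linarith)
          have h0 : 0 < (κ + 2) * A ^ σ := by positivity
          gcongr
          linarith

/-- If the measures of the balls are summable, almost every orbit hits only finitely many. -/
theorem ae_isBigO_of_summable {f : X → X} {ν : Measure X} [IsProbabilityMeasure ν]
    (hf : MeasurePreserving f ν ν) {c : X} {r : ℕ → ℝ}
    (hs : Summable fun n => ν.real (Metric.ball c (r n)))
    (hp : ∃ n, 1 ≤ n ∧ 0 < ν.real (Metric.ball c (r n))) :
    ∀ᵐ x ∂ν, ∀ β : ℝ,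
      (fun n => S f c r n x - E ν c r n) =O[atTop] fun n => E ν c r n ^ β := by
  obtain ⟨m, hm, hpm⟩ := hp
  have he0 : ∀ k, 0 ≤ ν.real (Metric.ball c (r k)) := fun k => measureReal_nonneg
  have hmeas : ∀ k, ν (f^[k] ⁻¹' Metric.ball c (r k)) = ENNReal.ofReal
      (ν.real (Metric.ball c (r k))) := fun k => by
    rw [(hf.iterate k).measure_preimage Metric.isOpen_ball.measurableSet.nullMeasurableSet,
      ofReal_measureReal]
  have hsum : ∑' k, ν (f^[k] ⁻¹' Metric.ball c (r k)) ≠ ⊤ := by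
    simp_rw [hmeas]
    exact hs.tsum_ofReal_ne_top
  have hmono : Monotone (E ν c r) := fun a b hab =>
    Finset.sum_le_sum_of_subset_of_nonneg (Finset.Icc_subset_Icc_right hab) fun k _ _ => he0 k
  have hElow : ∀ n, m ≤ n → ν.real (Metric.ball c (r m)) ≤ E ν c r n := fun n hn =>
    Finset.single_le_sum (f := fun k => ν.real (Metric.ball c (r k))) (fun k _ => he0 k)
      (Finset.mem_Icc.2 ⟨hm, hn⟩)
  have hEup : ∀ n, E ν c r n ≤ ∑' k, ν.real (Metric.ball c (r k)) := fun n =>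
    hs.sum_le_tsum _ fun k _ => he0 k
  have hElim : Tendsto (E ν c r) atTop (𝓝 (⨆ n, E ν c r n)) :=
    tendsto_atTop_ciSup hmono ⟨_, Set.forall_mem_range.2 hEup⟩
  -- S_n is eventually constant and E_n converges, so the difference is bounded. A positive limit of
  -- E_n keeps every power of it, even a negative one, away from 0.
  have hL : 0 < ⨆ n, E ν c r n :=
    (hpm.trans_le (hElow m le_rfl)).trans_le (le_ciSup ⟨_, Set.forall_mem_range.2 hEup⟩ m)
  filter_upwards [ae_eventually_notMem hsum] with x hx β
  obtain ⟨N, hN⟩ := eventually_atTop.1 hx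
  have hS : ∀ n, N ≤ n → S f c r n x = S f c r N x := by
    intro n hn
    refine (Finset.sum_subset (Finset.Icc_subset_Icc_right hn) fun k hk hk' => ?_).symm
    simp only [Finset.mem_Icc] at hk hk'
    exact Set.indicator_of_notMem (s := Metric.ball c (r k)) (hN k (by omega)) fun _ => (1 : ℝ)
  have h1 : Tendsto (fun n => S f c r n x - E ν c r n) atTop
      (𝓝 (S f c r N x - ⨆ n, E ν c r n)) :=
    ((tendsto_const_nhds (x := S f c r N x)).congr'
      ((eventually_ge_atTop N).mono fun n hn => (hS n hn).symm)).sub hElim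
  have h2 : Tendsto (fun n => E ν c r n ^ β) atTop (𝓝 ((⨆ n, E ν c r n) ^ β)) :=
    hElim.rpow_const (Or.inl hL.ne')
  refine (h1.isBigO_one ℝ).trans ?_
  have hLβ : 0 < (⨆ n, E ν c r n) ^ β := Real.rpow_pos_of_pos hL β
  refine (isBigO_const_left_iff_pos_le_norm one_ne_zero).2 ⟨_, half_pos hLβ, ?_⟩
  filter_upwards [h2.eventually_const_lt (half_lt_self hLβ)] with n hn
  exact hn.le.trans (Real.le_norm_self _)

end BorelCantelli

end ShrinkingBalls

/-! ### The theorem, with the exponential case split at β = -1. -/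

theorem proposition3p1 {d : ℕ} (X : Set (EuclideanSpace ℝ (Fin d)))
    (f : X → X) (ν : Measure X) [IsProbabilityMeasure ν] (hf : Ergodic f ν)
    (c : X) (δ : ℝ) (hδ : ShrinkingBalls.AnnulusRegular ν c δ)
    (hdim : ∃ D : ℝ, ShrinkingBalls.HasLocalDimension ν c D)
    (Θ : ℕ → ℝ) (hΘ : ShrinkingBalls.DecayOfCorrelations f ν Θ)
    (r : ℕ → ℝ) (hr : ShrinkingBalls.DecreasingBalls c r) :
    (∀ ζ β : ℝ, 0 < ζ → Θ =O[atTop] (fun n : ℕ => (n : ℝ) ^ (-ζ)) →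
      0 < β → β < 1 →
      (∀ᶠ n : ℕ in atTop, ν.real (Metric.ball c (r n)) = (n : ℝ) ^ (-β)) →
      ∀ᵐ x ∂ν, ∀ β' : ℝ, (2 * δ⁻¹ + β + ζ * (1 - β)) / (2 * ζ * (1 - β)) < β' →
        (fun n : ℕ => ShrinkingBalls.S f c r n x - ShrinkingBalls.E ν c r n)
          =O[atTop] (fun n : ℕ => ShrinkingBalls.E ν c r n ^ β')) ∧
    (∀ θ₀ β : ℝ, 0 < θ₀ → θ₀ < 1 → Θ =O[atTop] (fun n : ℕ => θ₀ ^ n) →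
      β ≠ -1 →
      (∀ᶠ n : ℕ in atTop, ν.real (Metric.ball c (r n)) = Real.log n ^ β / n) →
      ∀ᵐ x ∂ν, ∀ β' : ℝ, (2 + β) / (2 * (1 + β)) < β' →
        (fun n : ℕ => ShrinkingBalls.S f c r n x - ShrinkingBalls.E ν c r n)
          =O[atTop] (fun n : ℕ => ShrinkingBalls.E ν c r n ^ β')) := by
  have hmp := hf.toMeasurePreserving
  obtain ⟨D, hpos, -⟩ := hdim
  refine ⟨fun ζ β hζ hΘζ hβ0 hβ1 hB =>
    ShrinkingBalls.ae_isBigO_of_polynomial_decay hmp hΘ hδ hpos hζ hΘζ hβ0 hβ1 hB,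
    fun θ β hθ0 hθ1 hΘθ hβ hB => ?_⟩
  rcases lt_or_gt_of_ne hβ with hlt | hgt
  · have hs : Summable fun n => ν.real (Metric.ball c (r n)) := by
      refine summable_of_isBigO_nat (ShrinkingBalls.summable_log_rpow_div hlt) ?_
      exact EventuallyEq.isBigO hB
    have hp : ∃ n, 1 ≤ n ∧ 0 < ν.real (Metric.ball c (r n)) := by
      obtain ⟨n, hn, h2⟩ := (hB.and (eventually_ge_atTop 2)).exists
      refine ⟨n, by omega, ?_⟩
      have hn' : (2 : ℝ) ≤ n := by exact_mod_cast h2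
      have : 0 < Real.log n := Real.log_pos (by linarith)
      rw [hn]
      positivity
    filter_upwards [ShrinkingBalls.ae_isBigO_of_summable hmp hs hp] with x hx β' _
    exact hx β'
  · exact ShrinkingBalls.ae_isBigO_of_exponential_decay hmp hΘ hδ hpos hθ0 hθ1 hΘθ hgt hB
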